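/- Let $G$ be a finitely generated group, $H\le G$ a subgroup of finite index, and $\mu$ a probability measure on $G$ that is adapted (the semigroup generated by its support is $G$) and smooth ($\sum_x\mu(x)e^{\zeta|x|}<\infty$ for some $\zeta>0$, where $|\cdot|$ is a word length on $G$); no symmetry is assumed. Let $X_{t+1}=X_t\xi_{t+1}$ be the right random walk with i.i.d. increments $\xi_t$ of law $\mu$, $\mathbb P_x,\mathbb E_x$ its law and expectation when $X_0=x$, $\tau=\inf\{t\ge 0: X_t\in H\}$, $\tau^+=\inf\{t\ge1: X_t\in H\}$, and let $\mu_H(y)=\mathbb P_e(X_{\tau^+}=y)$, $y\in H$, be the hitting law. For a finite symmetric generating set $S$ put $\|\nabla_S f\|_\infty=\sup_{s\in S}\sup_x|f(xs)-f(x)|$; a function $f:G\to\mathbb C$ is Lipschitz if this is finite for one (equivalently every) $S$, and $\mathrm{LHF}(G,\mu)$ is the complex vector space of Lipschitz functions with $f(k)=\sum_g\mu(g)f(kg)$ (absolutely convergent) for all $k$; likewise for $H$ and $\mu_H$. Then $\mu_H$ is a probability measure on $H$, $T:=\sup_{x\in G}\mathbb E_x[\tau]<\infty$, the expectations below exist,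 and the maps $$\mathrm{Res}_H^G:\mathrm{LHF}(G,\mu)\to\mathrm{LHF}(H,\mu_H),\ f\mapsto f|_H,\qquad \mathrm{Ind}_H^G:\mathrm{LHF}(H,\mu_H)\to\mathrm{LHF}(G,\mu),\ \tilde f\mapsto\big(x\mapsto\mathbb E_x[\tilde f(X_\tau)]\big)$$ are well defined, linear, and inverse to each other. (Lipschitz control) Let $S_G,S_H$ be finite symmetric generating sets of $G$ and $H$, with word lengths $|\cdot|_{S_G},|\cdot|_{S_H}$. The first moment $m_1=\sum_x\mu(x)|x|_{S_G}$ is finite, and there is $A\ge1$ with $|h|_{S_H}\le A|h|_{S_G}$ for all $h\in H$. With $C_{H,G}=\max_{s\in S_H}|s|_{S_G}$ one has $\|\nabla_{S_H}(\mathrm{Res}_H^Gf)\|_\infty\le C_{H,G}\|\nabla_{S_G}f\|_\infty$ for all $f\in\mathrm{LHF}(G,\mu)$. For every such $A$ and every set $F\ni e$ of representatives of the right cosets $Hg$ of $H$ in $G$, with $D=\max_{g\in F}|g|_{S_G}$, one has, for all $\tilde f\in\mathrm{LHF}(H,\mu_H)$, $$\|\nabla_{S_G}(\mathrm{Ind}_H^G\tilde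 f)\|_\infty\le C_*\|\nabla_{S_H}\tilde f\|_\infty,\qquad C_*=A\big((4D+1)+2m_1T\big).$$ (F1) If $K\le H$ also has finite index in $G$, then the hitting law of $\mu_H$ on $K$ is $\mu_K$, $\mathrm{Res}_K^H\circ\mathrm{Res}_H^G=\mathrm{Res}_K^G$ on $\mathrm{LHF}(G,\mu)$, and, with $\mathrm{Ind}_K^H$ formed with respect to $\mu_H$, $\mathrm{Ind}_K^H$ maps $\mathrm{LHF}(K,\mu_K)$ to $\mathrm{LHF}(H,\mu_H)$ and $\mathrm{Ind}_H^G\circ\mathrm{Ind}_K^H=\mathrm{Ind}_K^G$ on $\mathrm{LHF}(K,\mu_K)$. (F2) For $h\in H$ the left translation $L_hf(x)=f(h^{-1}x)$ preserves $\mathrm{LHF}(G,\mu)$ and $\mathrm{LHF}(H,\mu_H)$, and $\mathrm{Res}_H^G(L_hf)=L_h(\mathrm{Res}_H^Gf)$, $\mathrm{Ind}_H^G(L_h\tilde f)=L_h(\mathrm{Ind}_H^G\tilde f)$. (F3) For $g\in G$ let $c(x)=gxg^{-1}$, $H^g=gHg^{-1}$ and $\mu^g=c_*\mu$. Then the hitting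 law of $\mu^g$ on $H^g$ is $(c|_H)_*\mu_H$; $f\mapsto f\circ c^{-1}$ identifies $\mathrm{LHF}(G,\mu)$ with $\mathrm{LHF}(G,\mu^g)$ and $\mathrm{LHF}(H,\mu_H)$ with $\mathrm{LHF}(H^g,(\mu^g)_{H^g})$; and under these identifications $\mathrm{Res}_{H^g}^G$ and $\mathrm{Ind}_{H^g}^G$ (with respect to $\mu^g$) correspond to $\mathrm{Res}_H^G$ and $\mathrm{Ind}_H^G$ (with respect to $\mu$). -/

import Mathlib

open MeasureTheory
open scoped ENNReal NNReal

noncomputable section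

namespace FiniteIndexLHF

/-! ### Word metrics and the Lipschitz seminorm -/

section Word

variable {G : Type*} [Group G]

/-- `S` is a (finite) symmetric generating set of the group `G`. -/
structure IsSymmGen (S : Finset G) : Prop where
  inv_mem : ∀ s ∈ S, s⁻¹ ∈ S
  closure_eq_top : Subgroup.closure (S : Set G) = ⊤

/-- The word length `|g|_S`: the least length of a word in `S` representing `g`. -/
def wordLength (S : Finset G) (g : G) : ℕ :=
  sInf {n : ℕ | ∃ l : List G, (∀ s ∈ l, s ∈ S) ∧ l.prod = g ∧ l.length = n}

/-- The Lipschitz seminorm `‖∇_S f‖_∞ = sup_{s ∈ S} sup_x |f (x s) - f x|`,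
as an extended nonnegative number. -/
def gradNorm (S : Finset G) (f : G → ℂ) : ℝ≥0∞ :=
  ⨆ s ∈ S, ⨆ x : G, ‖f (x * s) - f x‖ₑ

/-- `f` is Lipschitz: `‖∇_S f‖_∞ < ∞` for finite symmetric generating sets `S`.
By `isLipschitz_iff` below one such `S` suffices. -/
def IsLipschitz (f : G → ℂ) : Prop :=
  ∀ S : Finset G, IsSymmGen S → gradNorm S f < ∞

theorem gradNorm_lt_top_of_lt_top {S T : Finset G} (hS : IsSymmGen S) {f : G → ℂ}
    (hf : gradNorm S f < ∞) : gradNorm T f < ∞ := by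
  have key : ∀ t : G, ∃ C : ℝ≥0, ∀ x : G, ‖f (x * t) - f x‖ₑ ≤ C := by
    intro t
    have ht : t ∈ Subgroup.closure (S : Set G) := by
      rw [hS.closure_eq_top]; trivial
    induction ht using Subgroup.closure_induction with
    | mem s hs =>
      refine ⟨(gradNorm S f).toNNReal, fun x => ?_⟩
      rw [ENNReal.coe_toNNReal hf.ne]
      exact (le_iSup (fun x : G => ‖f (x * s) - f x‖ₑ) x).trans
        (le_iSup₂ (f := fun s (_ : s ∈ S) => ⨆ x : G, ‖f (x * s) - f x‖ₑ) s hs)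
    | one => exact ⟨0, fun x => by simp⟩
    | mul a b _ _ iha ihb =>
      obtain ⟨A, hA⟩ := iha
      obtain ⟨B, hB⟩ := ihb
      refine ⟨B + A, fun x => ?_⟩
      have h : f (x * (a * b)) - f x = (f (x * a * b) - f (x * a)) + (f (x * a) - f x) := by
        rw [← mul_assoc]; ring
      rw [h, ENNReal.coe_add]
      exact (enorm_add_le _ _).trans (add_le_add (hB _) (hA _))
    | inv a _ iha =>
      obtain ⟨A, hA⟩ := iha
      refine ⟨A, fun x => ?_⟩
      have h := hA (x * a⁻¹)
      rw [inv_mul_cancel_right] at h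
      rwa [← enorm_neg, neg_sub]
  choose C hC using key
  refine lt_of_le_of_lt (b := ((T.sup C : ℝ≥0) : ℝ≥0∞)) ?_ ENNReal.coe_lt_top
  refine iSup₂_le fun t ht => iSup_le fun x => (hC t x).trans ?_
  exact_mod_cast Finset.le_sup (f := C) ht

theorem isLipschitz_iff {S : Finset G} (hS : IsSymmGen S) {f : G → ℂ} :
    IsLipschitz f ↔ gradNorm S f < ∞ :=
  ⟨fun h => h S hS, fun h _ _ => gradNorm_lt_top_of_lt_top hS h⟩

/-- Left translation `(L_h f)(x) = f (h⁻¹ x)`. -/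
def leftTranslate (h : G) (f : G → ℂ) : G → ℂ := fun x => f (h⁻¹ * x)

/-- Restriction of functions to a subgroup. -/
def res (H : Subgroup G) (f : G → ℂ) : H → ℂ := fun h => f h

/-- The conjugate subgroup `g H g⁻¹`. -/
def conjSubgroup (g : G) (H : Subgroup G) : Subgroup G :=
  H.map (MulAut.conj g).toMonoidHom

/-- The isomorphism `H ≃ g H g⁻¹`, `h ↦ g h g⁻¹`. -/
def conjEquiv (g : G) (H : Subgroup G) : H ≃* conjSubgroup g H :=
  (MulAut.conj g).subgroupMap H

@[simp] theorem coe_conjEquiv (g : G) (H : Subgroup G) (h : H) :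
    (conjEquiv g H h : G) = g * h * g⁻¹ := rfl

end Word

/-! ### Measures on groups and Lipschitz harmonic functions

Groups carry the discrete σ-algebra. -/

section Measures

variable {G : Type*} [Group G] [MeasurableSpace G]

/-- `μ` is adapted: the semigroup generated by its support is all of `G`. -/
def IsAdapted (μ : Measure G) : Prop :=
  Subsemigroup.closure {g : G | μ {g} ≠ 0} = ⊤

/-- `μ` is smooth: `∑ x, μ x * exp (ζ |x|_S) < ∞` for some `ζ > 0`
(and some, equivalently every, finite symmetric generating set `S`). -/
def IsSmooth (μ : Measure G) : Prop :=
  ∃ S : Finset G, IsSymmGen S ∧ ∃ ζ : ℝ, 0 < ζ ∧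
    ∫⁻ x, ENNReal.ofReal (Real.exp (ζ * wordLength S x)) ∂μ < ∞

/-- The first moment `∑ x, μ x * |x|_S`. -/
def firstMoment (S : Finset G) (μ : Measure G) : ℝ≥0∞ :=
  ∫⁻ x, (wordLength S x : ℝ≥0∞) ∂μ

/-- `f` is `μ`-harmonic: `f k = ∑ g, μ g * f (k g)` for all `k`, with absolute convergence. -/
def IsHarmonic (μ : Measure G) (f : G → ℂ) : Prop :=
  ∀ k : G, Integrable (fun g => f (k * g)) μ ∧ f k = ∫ g, f (k * g) ∂μ

/-- The space of Lipschitz `μ`-harmonic functions on `G`. -/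
def LHF (μ : Measure G) : Submodule ℂ (G → ℂ) where
  carrier := {f | IsLipschitz f ∧ IsHarmonic μ f}
  zero_mem' := ⟨fun S _ => by simp [gradNorm], fun k => by simp⟩
  add_mem' := by
    rintro f g ⟨hf, hf'⟩ ⟨hg, hg'⟩
    refine ⟨fun S hS => ?_, fun k => ⟨(hf' k).1.add (hg' k).1, ?_⟩⟩
    · refine lt_of_le_of_lt ?_ (ENNReal.add_lt_top.2 ⟨hf S hS, hg S hS⟩)
      refine iSup₂_le fun s hs => iSup_le fun x => ?_
      have h : (f + g) (x * s) - (f + g) x = (f (x * s) - f x) + (g (x * s) - g x) := by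
        simp only [Pi.add_apply]; ring
      rw [h]
      refine (enorm_add_le _ _).trans (add_le_add ?_ ?_)
      · exact (le_iSup (fun x : G => ‖f (x * s) - f x‖ₑ) x).trans
          (le_iSup₂ (f := fun s (_ : s ∈ S) => ⨆ x : G, ‖f (x * s) - f x‖ₑ) s hs)
      · exact (le_iSup (fun x : G => ‖g (x * s) - g x‖ₑ) x).trans
          (le_iSup₂ (f := fun s (_ : s ∈ S) => ⨆ x : G, ‖g (x * s) - g x‖ₑ) s hs)
    · simp only [Pi.add_apply]
      rw [integral_add (hf' k).1 (hg' k).1, ← (hf' k).2, ← (hg' k).2]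
  smul_mem' := by
    rintro c f ⟨hf, hf'⟩
    refine ⟨fun S hS => ?_, fun k => ⟨(hf' k).1.smul c, ?_⟩⟩
    · refine lt_of_le_of_lt ?_ (ENNReal.mul_lt_top (enorm_lt_top (x := c)) (hf S hS))
      refine iSup₂_le fun s hs => iSup_le fun x => ?_
      have h : (c • f) (x * s) - (c • f) x = c * (f (x * s) - f x) := by
        simp only [Pi.smul_apply, smul_eq_mul]; ring
      rw [h, enorm_mul]
      gcongr
      exact (le_iSup (fun x : G => ‖f (x * s) - f x‖ₑ) x).trans
          (le_iSup₂ (f := fun s (_ : s ∈ S) => ⨆ x : G, ‖f (x * s) - f x‖ₑ) s hs)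
    · simp only [Pi.smul_apply, smul_eq_mul]
      rw [integral_const_mul, ← (hf' k).2]

/-! ### The right random walk, hitting law and harmonic induction -/

/-- The right random walk `X_0 = x`, `X_{t+1} = X_t ξ_{t+1}`, as a function of the sequence
of increments; the increment `ξ_{t+1}` is the coordinate `ω t`. -/
def walk (x : G) : ℕ → (ℕ → G) → G
  | 0, _ => x
  | t + 1, ω => walk x t ω * ω t

/-- The law of the increments `(ξ_1, ξ_2, …)`: they are i.i.d. with law `μ`. -/
def incrementLaw (μ : Measure G) : Measure (ℕ → G) :=
  Measure.infinitePi fun _ => μ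

/-- The first time `t ≥ n` at which the walk started at `x` is in `H` (`⊤` if there is none).
So `n = 0` gives `τ` and `n = 1` gives `τ⁺`. -/
def hitTime (H : Subgroup G) (n : ℕ) (x : G) : (ℕ → G) → ℕ∞ :=
  hittingAfter (walk x) (H : Set G) n

open scoped Classical in
/-- The position, as an element of `H`, of the walk started at `x` at its first time `t ≥ n` in
`H`. The value `1` is a convention for increments for which this time is infinite. -/
def hitPlace (H : Subgroup G) (n : ℕ) (x : G) (ω : ℕ → G) : H :=
  if h : stoppedValue (walk x) (hitTime H n x) ω ∈ H then ⟨_, h⟩ else 1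

/-- The expected hitting time `𝔼_x[τ]`. -/
def expectedHitTime (H : Subgroup G) (μ : Measure G) (x : G) : ℝ≥0∞ :=
  ∫⁻ ω, (hitTime H 0 x ω : ℝ≥0∞) ∂(incrementLaw μ)

/-- The hitting law `μ_H y = ℙ_e(τ⁺ < ∞, X_{τ⁺} = y)` on `H`. -/
def hittingMeasure (H : Subgroup G) (μ : Measure G) : Measure H :=
  ((incrementLaw μ).restrict {ω | hitTime H 1 1 ω < ⊤}).map (hitPlace H 1 1)

/-- Harmonic induction `x ↦ 𝔼_x[f (X_τ)]`. -/
def ind (H : Subgroup G) (μ : Measure G) (f : H → ℂ) : G → ℂ :=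
  fun x => ∫ ω, f (hitPlace H 0 x ω) ∂(incrementLaw μ)

end Measures

end FiniteIndexLHF

end

open FiniteIndexLHF

/-! Left multiplication by an element of `H` commutes with the right walk and preserves its visits
to `H`, so the law of τ depends only on the coset `Hx`. There are finitely many cosets, and
adaptedness gives from each a positive chance of reaching `H` in bounded time. Hence ℙ_x(τ > n)
shrinks by a factor `a < 1` every `N` steps, uniformly in `x`, and T < ∞ (`exists_hitTail_le`,
`hitTail_add_le`). Wald's identity `lintegral_pathLength` then bounds the expected displacement up
to τ by m₁T. Since `H` is undistorted in `G`, this gives both integrability and the Lipschitz bound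
for induced functions (`gradNorm_ind_le`).

Conditioning on the first increment makes an induced function harmonic off `H`. The same
conditioning applied to τ⁺ shows that its harmonicity at points of `H` is exactly harmonicity of the
original function for the hitting law (`integral_hittingMeasure`). That Ind ∘ Res is the identity,
and that restrictions are harmonic, follows from uniqueness for the Dirichlet problem
(`eq_ind_res`): a Lipschitz function vanishing on `H` is bounded by some C, and if it is harmonic
off `H` it is at most C ℙ_x(τ > n) for every n, hence zero.

For (F1) the same uniqueness replaces the concatenation of hitting times; it is applied to `H` with
its hitting law, which is again adapted with finite first moment (`isAdapted_hittingMeasure`,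
`hasFirstMoment_hittingMeasure`). The exponential moment serves only to give a finite first moment.
(F2) is left equivariance of the walk, and (F3) its transport along an isomorphism. -/

namespace FiniteIndexLHF

/-! ### Word lengths and Lipschitz functions -/

section WordLength

variable {G : Type*} [Group G]

theorem wordLength_prod_le {S : Finset G} {l : List G} (hl : ∀ s ∈ l, s ∈ S) :
    wordLength S l.prod ≤ l.length :=
  Nat.sInf_le ⟨l, hl, rfl, rfl⟩

theorem IsSymmGen.exists_list_prod {S : Finset G} (hS : IsSymmGen S) (g : G) :
    ∃ l : List G, (∀ s ∈ l, s ∈ S) ∧ l.prod = g := by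
  have hg : g ∈ Subgroup.closure (S : Set G) := by rw [hS.closure_eq_top]; trivial
  rw [← Subgroup.mem_toSubmonoid, Subgroup.closure_toSubmonoid] at hg
  obtain ⟨l, hl, rfl⟩ := Submonoid.exists_list_of_mem_closure hg
  refine ⟨l, fun s hs => ?_, rfl⟩
  rcases hl s hs with h | h
  · exact h
  · simpa using hS.inv_mem _ h

theorem IsSymmGen.exists_list_length {S : Finset G} (hS : IsSymmGen S) (g : G) :
    ∃ l : List G, (∀ s ∈ l, s ∈ S) ∧ l.prod = g ∧ l.length = wordLength S g := by
  obtain ⟨l, hl, hg⟩ := hS.exists_list_prod g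
  exact Nat.sInf_mem (s := {n : ℕ | ∃ l : List G, (∀ s ∈ l, s ∈ S) ∧ l.prod = g ∧ l.length = n})
    ⟨_, l, hl, hg, rfl⟩

@[simp] theorem wordLength_one (S : Finset G) : wordLength S (1 : G) = 0 := by
  have h := wordLength_prod_le (S := S) (l := []) (by simp)
  simpa using h

theorem wordLength_le_one {S : Finset G} {s : G} (hs : s ∈ S) : wordLength S s ≤ 1 := by
  simpa using wordLength_prod_le (S := S) (l := [s]) (by simpa using hs)

theorem IsSymmGen.wordLength_mul_le {S : Finset G} (hS : IsSymmGen S) (g h : G) :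
    wordLength S (g * h) ≤ wordLength S g + wordLength S h := by
  obtain ⟨l, hl, rfl, hl'⟩ := hS.exists_list_length g
  obtain ⟨m, hm, rfl, hm'⟩ := hS.exists_list_length h
  rw [← hl', ← hm', ← List.prod_append, ← List.length_append]
  refine wordLength_prod_le fun s hs => ?_
  rcases List.mem_append.1 hs with h | h
  exacts [hl s h, hm s h]

theorem IsSymmGen.wordLength_inv_le {S : Finset G} (hS : IsSymmGen S) (g : G) :
    wordLength S g⁻¹ ≤ wordLength S g := by
  obtain ⟨l, hl, rfl, hl'⟩ := hS.exists_list_length g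
  rw [← hl', List.prod_inv_reverse]
  refine (wordLength_prod_le fun s hs => ?_).trans (by simp)
  simp only [List.mem_reverse, List.mem_map] at hs
  obtain ⟨a, ha, rfl⟩ := hs
  exact hS.inv_mem a (hl a ha)

/-- Induction along a word in the generators. -/
theorem IsSymmGen.induction_on {S : Finset G} (hS : IsSymmGen S) {p : ℕ → G → Prop}
    (one : p 0 1) (mul : ∀ n g s, s ∈ S → p n g → p (n + 1) (g * s)) (g : G) :
    p (wordLength S g) g := by
  obtain ⟨l, hl, rfl, hl'⟩ := hS.exists_list_length g
  rw [← hl']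
  clear hl'
  induction l using List.reverseRecOn with
  | nil => simpa using one
  | append_singleton l s ih =>
    simp only [List.length_append, List.length_singleton, List.prod_append, List.prod_singleton]
    exact mul _ _ _ (hl s (by simp)) (ih fun a ha => hl a (by simp [ha]))

theorem exists_isSymmGen (G : Type*) [Group G] [Group.FG G] : ∃ S : Finset G, IsSymmGen S := by
  classical
  obtain ⟨S, hS⟩ := Group.fg_def.1 (inferInstance : Group.FG G)
  refine ⟨S ∪ S.image (·⁻¹), ⟨fun s hs => ?_, ?_⟩⟩
  · simp only [Finset.mem_union, Finset.mem_image] at hs ⊢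
    rcases hs with hs | ⟨a, ha, rfl⟩
    · exact Or.inr ⟨s, hs, rfl⟩
    · exact Or.inl (by simpa using ha)
  · rw [eq_top_iff, ← hS]
    exact Subgroup.closure_mono (by simp)

theorem countable_of_fg (G : Type*) [Group G] [Group.FG G] : Countable G := by
  obtain ⟨S, hS⟩ := exists_isSymmGen G
  refine Function.Surjective.countable (f := fun l : List S => (l.map Subtype.val).prod) fun g => ?_
  obtain ⟨l, hl, rfl⟩ := hS.exists_list_prod g
  exact ⟨l.attach.map fun s => ⟨s.1, hl _ s.2⟩, by simp [List.map_map, Function.comp_def]⟩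

theorem enorm_sub_le_gradNorm {S : Finset G} (f : G → ℂ) {s : G} (hs : s ∈ S) (x : G) :
    ‖f (x * s) - f x‖ₑ ≤ gradNorm S f :=
  (le_iSup (fun x : G => ‖f (x * s) - f x‖ₑ) x).trans
    (le_iSup₂ (f := fun s (_ : s ∈ S) => ⨆ x : G, ‖f (x * s) - f x‖ₑ) s hs)

theorem gradNorm_le_iff {S : Finset G} {f : G → ℂ} {C : ℝ≥0∞} :
    gradNorm S f ≤ C ↔ ∀ s ∈ S, ∀ x, ‖f (x * s) - f x‖ₑ ≤ C := by
  simp [gradNorm]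

theorem IsSymmGen.enorm_sub_le {S : Finset G} (hS : IsSymmGen S) (f : G → ℂ) (x g : G) :
    ‖f (x * g) - f x‖ₑ ≤ wordLength S g * gradNorm S f := by
  refine hS.induction_on (p := fun n g => ‖f (x * g) - f x‖ₑ ≤ n * gradNorm S f) (by simp)
    (fun n g s hs h => ?_) g
  have : f (x * (g * s)) - f x = (f (x * g * s) - f (x * g)) + (f (x * g) - f x) := by
    rw [mul_assoc]; ring
  rw [this, Nat.cast_succ, add_mul, one_mul, add_comm ((n : ℝ≥0∞) * _)]
  exact (enorm_add_le _ _).trans (add_le_add (enorm_sub_le_gradNorm f hs _) h)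

/-- For the inclusion of `H` the constant is C_{H,G}, which is the Lipschitz bound for restriction.
-/
theorem gradNorm_comp_le {G' : Type*} [Group G'] {S : Finset G} (hS : IsSymmGen S) (T : Finset G')
    (φ : G' →* G) (f : G → ℂ) :
    gradNorm T (f ∘ φ) ≤ ((T.sup fun t => wordLength S (φ t) : ℕ) : ℝ≥0∞) * gradNorm S f := by
  refine gradNorm_le_iff.2 fun t ht x => ?_
  simp only [Function.comp, map_mul]
  refine (hS.enorm_sub_le f _ _).trans ?_
  gcongr
  exact Finset.le_sup (f := fun t => wordLength S (φ t)) ht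

theorem IsLipschitz.comp [Group.FG G] {G' : Type*} [Group G'] {f : G → ℂ} (hf : IsLipschitz f)
    (φ : G' →* G) : IsLipschitz (f ∘ φ) := by
  intro T _
  obtain ⟨S, hS⟩ := exists_isSymmGen G
  exact (gradNorm_comp_le hS T φ f).trans_lt (ENNReal.mul_lt_top (by simp) (hf S hS))

theorem IsLipschitz.sub {f g : G → ℂ} (hf : IsLipschitz f) (hg : IsLipschitz g) :
    IsLipschitz (f - g) := by
  intro S hS
  refine lt_of_le_of_lt (gradNorm_le_iff.2 fun s hs x => ?_)
    (ENNReal.add_lt_top.2 ⟨hf S hS, hg S hS⟩)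
  have h : (f - g) (x * s) - (f - g) x = (f (x * s) - f x) - (g (x * s) - g x) := by
    simp only [Pi.sub_apply]; ring
  rw [h]
  exact enorm_sub_le.trans
    (add_le_add (enorm_sub_le_gradNorm f hs x) (enorm_sub_le_gradNorm g hs x))

/-- Lets indicators of points serve as Lipschitz test functions when two hitting laws are compared.
-/
theorem isLipschitz_of_bounded {f : G → ℂ} {C : ℝ≥0} (hf : ∀ x, ‖f x‖ₑ ≤ C) :
    IsLipschitz f := fun S _ =>
  lt_of_le_of_lt (b := ((C + C : ℝ≥0) : ℝ≥0∞))
    (gradNorm_le_iff.2 fun s _ x => enorm_sub_le.trans (by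
      rw [ENNReal.coe_add]; exact add_le_add (hf _) (hf _))) ENNReal.coe_lt_top

theorem gradNorm_leftTranslate_le (S : Finset G) (h : G) (f : G → ℂ) :
    gradNorm S (leftTranslate h f) ≤ gradNorm S f :=
  gradNorm_le_iff.2 fun s hs x => by
    simpa only [leftTranslate, mul_assoc] using enorm_sub_le_gradNorm f hs (h⁻¹ * x)

theorem IsLipschitz.leftTranslate {f : G → ℂ} (hf : IsLipschitz f) (h : G) :
    IsLipschitz (leftTranslate h f) := fun S hS =>
  (gradNorm_leftTranslate_le S h f).trans_lt (hf S hS)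

theorem IsSymmGen.exists_wordLength_le_mul {S : Finset G} (hS : IsSymmGen S) {T : Finset G}
    (hT : IsSymmGen T) : ∃ C : ℕ, ∀ g, wordLength T g ≤ C * wordLength S g := by
  refine ⟨S.sup (wordLength T), hS.induction_on
    (p := fun n g => wordLength T g ≤ S.sup (wordLength T) * n) (by simp) fun n g s hs h => ?_⟩
  rw [mul_add, mul_one]
  exact (hT.wordLength_mul_le _ _).trans (add_le_add h (Finset.le_sup hs))

end WordLength

/-! ### Coset representatives and undistortedness -/

section Transversal

variable {G : Type*} [Group G] {H : Subgroup G}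

theorem exists_finset_isComplement (H : Subgroup G) [H.FiniteIndex] :
    ∃ F : Finset G, Subgroup.IsComplement (H : Set G) (F : Set G) ∧ 1 ∈ F := by
  obtain ⟨F, hF, h1⟩ := H.exists_isComplement_right 1
  refine ⟨hF.finite_right.toFinset, ?_, ?_⟩ <;> simpa

theorem exists_mul_eq {F : Finset G} (hF : Subgroup.IsComplement (H : Set G) (F : Set G))
    (x : G) : ∃ h : H, ∃ g ∈ F, (h : G) * g = x :=
  ⟨(hF.equiv x).1, (hF.equiv x).2, (hF.equiv x).2.2, hF.equiv_fst_mul_equiv_snd x⟩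

/-- A subgroup of finite index is undistorted. -/
theorem exists_wordLength_subgroup_le [H.FiniteIndex] {S : Finset G} (hS : IsSymmGen S)
    {T : Finset H} (hT : IsSymmGen T) :
    ∃ C : ℕ, ∀ h : H, wordLength T h ≤ C * wordLength S (h : G) := by
  classical
  obtain ⟨F, hF, h1⟩ := exists_finset_isComplement H
  have hF' : ∀ h : H, (hF.equiv (h : G)).1 = h := fun h =>
    hF.equiv_fst_eq_self_of_mem_of_one_mem h1 h.2
  -- Schreier's argument: if `g = h r` with `r ∈ F`, the `H`-part of `g s` is `h` times the `H`-part
  -- of `r s`, and only finitely many `r s` occur. Since `1 ∈ F`, an element of `H` is its own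
  -- `H`-part.
  let M : ℕ := (F ×ˢ S).sup fun p => wordLength T (hF.equiv (p.1 * p.2)).1
  have key : ∀ x : G, wordLength T (hF.equiv x).1 ≤ M * wordLength S x := by
    refine hS.induction_on (p := fun n x => wordLength T (hF.equiv x).1 ≤ M * n) ?_
      fun n g s hs h => ?_
    · have := hF' 1
      simp only [Subgroup.coe_one] at this
      simp [this]
    · have hx : g * s = ((hF.equiv g).1 : H) * ((hF.equiv g).2 * s) := by
        rw [← mul_assoc, hF.equiv_fst_mul_equiv_snd]
      rw [hx, hF.equiv_mul_left, mul_add, mul_one]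
      exact (hT.wordLength_mul_le _ _).trans (add_le_add h
        (Finset.le_sup (f := fun p : G × G => wordLength T (hF.equiv (p.1 * p.2)).1)
          (Finset.mk_mem_product (hF.equiv g).2.2 hs)))
  exact ⟨M, fun h => by simpa [hF' h] using key h⟩

/-- Every point lies within bounded distance of `H`, where the function vanishes. -/
theorem bounded_of_isLipschitz_of_eq_zero [Group.FG G] [H.FiniteIndex] {f : G → ℂ}
    (hf : IsLipschitz f) (h0 : ∀ h : H, f h = 0) : ∃ C : ℝ≥0, ∀ x, ‖f x‖ₑ ≤ C := by
  obtain ⟨S, hS⟩ := exists_isSymmGen G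
  obtain ⟨F, hF, -⟩ := exists_finset_isComplement H
  refine ⟨(F.sup (wordLength S) : ℕ) * (gradNorm S f).toNNReal, fun x => ?_⟩
  obtain ⟨h, g, hg, rfl⟩ := exists_mul_eq hF x
  have := hS.enorm_sub_le f h g
  rw [h0, sub_zero] at this
  refine this.trans ?_
  rw [ENNReal.coe_mul, ENNReal.coe_toNNReal (hf S hS).ne, ENNReal.coe_natCast]
  gcongr
  exact Finset.le_sup (f := wordLength S) hg

end Transversal

/-! ### Prepending an increment -/

section ConsIncr

variable {G : Type*}

/-- Prepend an increment to a sequence of increments. -/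
def consIncr (g : G) (ω : ℕ → G) : ℕ → G
  | 0 => g
  | n + 1 => ω n

@[simp] theorem consIncr_zero (g : G) (ω : ℕ → G) : consIncr g ω 0 = g := rfl

@[simp] theorem consIncr_succ (g : G) (ω : ℕ → G) (n : ℕ) : consIncr g ω (n + 1) = ω n := rfl

theorem measurable_consIncr [MeasurableSpace G] : Measurable fun p : G × (ℕ → G) => consIncr p.1 p.2 := by
  refine measurable_pi_iff.2 fun n => ?_
  cases n with
  | zero => exact measurable_fst
  | succ n => exact (measurable_pi_apply n).comp measurable_snd

end ConsIncr

/-! ### Pathwise identities for hitting times and places -/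

section Paths

variable {G : Type*} [Group G]

@[simp] theorem walk_zero (x : G) (ω : ℕ → G) : walk x 0 ω = x := rfl

theorem walk_succ (x : G) (t : ℕ) (ω : ℕ → G) : walk x (t + 1) ω = walk x t ω * ω t := rfl

theorem walk_consIncr (x g : G) (t : ℕ) (ω : ℕ → G) :
    walk x (t + 1) (consIncr g ω) = walk (x * g) t ω := by
  induction t with
  | zero => rfl
  | succ t ih => rw [walk_succ, ih, walk_succ, consIncr_succ]

theorem walk_left_mul (h x : G) (t : ℕ) (ω : ℕ → G) : walk (h * x) t ω = h * walk x t ω := by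
  induction t with
  | zero => rfl
  | succ t ih => rw [walk_succ, ih, walk_succ, mul_assoc]

theorem walk_map {G' : Type*} [Group G'] (φ : G →* G') (x : G) (t : ℕ) (ω : ℕ → G) :
    walk (φ x) t (fun i => φ (ω i)) = φ (walk x t ω) := by
  induction t with
  | zero => rfl
  | succ t ih => rw [walk_succ, ih, walk_succ, map_mul]

theorem wordLength_inv_mul_walk_le {S : Finset G} (hS : IsSymmGen S) (x : G) (t : ℕ)
    (ω : ℕ → G) :
    wordLength S (x⁻¹ * walk x t ω) ≤ ∑ i ∈ Finset.range t, wordLength S (ω i) := by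
  induction t with
  | zero => simp
  | succ t ih =>
    rw [walk_succ, ← mul_assoc, Finset.sum_range_succ]
    exact (hS.wordLength_mul_le _ _).trans (Nat.add_le_add_right ih _)

variable {H : Subgroup G} {n : ℕ} {x : G} {ω : ℕ → G}

theorem hitTime_eq_top_iff : hitTime H n x ω = ⊤ ↔ ∀ t, n ≤ t → walk x t ω ∉ H :=
  hittingAfter_eq_top_iff

theorem hitTime_le_coe_iff {t : ℕ} :
    hitTime H n x ω ≤ t ↔ ∃ s, n ≤ s ∧ s ≤ t ∧ walk x s ω ∈ H := by
  have h := hittingAfter_le_iff (u := walk x) (s := (H : Set G)) (n := n) (ω := ω) (i := t)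
  simp only [Set.mem_Icc, SetLike.mem_coe, and_assoc] at h
  exact h

theorem coe_lt_hitTime_iff {t : ℕ} :
    (t : ℕ∞) < hitTime H n x ω ↔ ∀ s, n ≤ s → s ≤ t → walk x s ω ∉ H := by
  rw [← not_le, hitTime_le_coe_iff]
  push Not
  rfl

theorem hitTime_eq_coe_iff {t : ℕ} :
    hitTime H n x ω = t ↔ n ≤ t ∧ walk x t ω ∈ H ∧ ∀ s, n ≤ s → s < t → walk x s ω ∉ H := by
  constructor
  · intro h
    have h1 := hitTime_le_coe_iff.1 h.le
    have h2 : ∀ s, n ≤ s → s < t → walk x s ω ∉ H := fun s hs hst hm =>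
      absurd (hitTime_le_coe_iff.2 ⟨s, hs, le_rfl, hm⟩)
        (by rw [h, not_le]; exact_mod_cast hst)
    obtain ⟨s, hs, hst, hm⟩ := h1
    obtain rfl : s = t := by
      by_contra hne
      exact h2 s hs (lt_of_le_of_ne hst hne) hm
    exact ⟨hs, hm, h2⟩
  · rintro ⟨h1, h2, h3⟩
    refine le_antisymm (hitTime_le_coe_iff.2 ⟨t, h1, le_rfl, h2⟩) ?_
    refine le_of_not_gt fun hlt => ?_
    obtain ⟨k, hk⟩ := ENat.ne_top_iff_exists.1 hlt.ne_top
    obtain ⟨s, hs, hsk, hm⟩ := hitTime_le_coe_iff.1 hk.ge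
    rw [← hk] at hlt
    exact h3 s hs (hsk.trans_lt (by exact_mod_cast hlt)) hm

/-- A hitting time depends only on the set of times of visits; equivariance and transport are
instances. -/
theorem hitTime_congr {G' : Type*} [Group G'] {H' : Subgroup G'} {x' : G'} {ω' : ℕ → G'}
    (h : ∀ t, n ≤ t → (walk x t ω ∈ H ↔ walk x' t ω' ∈ H')) :
    hitTime H n x ω = hitTime H' n x' ω' := by
  rcases eq_or_ne (hitTime H' n x' ω') ⊤ with h' | h'
  · rw [h', hitTime_eq_top_iff]
    rw [hitTime_eq_top_iff] at h'
    exact fun t ht => (h t ht).not.2 (h' t ht)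
  · obtain ⟨k, hk⟩ := ENat.ne_top_iff_exists.1 h'
    obtain ⟨h1, h2, h3⟩ := hitTime_eq_coe_iff.1 hk.symm
    rw [← hk, hitTime_eq_coe_iff]
    exact ⟨h1, (h k h1).2 h2, fun s hs hsk => (h s hs).not.2 (h3 s hs hsk)⟩

theorem hitTime_left_mul {h : G} (hh : h ∈ H) : hitTime H n (h * x) ω = hitTime H n x ω :=
  hitTime_congr fun t _ => by rw [walk_left_mul, H.mul_mem_cancel_left hh]

theorem hitTime_zero_of_mem (hx : x ∈ H) : hitTime H 0 x ω = 0 := by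
  have := (hitTime_eq_coe_iff (H := H) (n := 0) (x := x) (ω := ω) (t := 0)).2
    ⟨le_rfl, hx, by simp⟩
  simpa using this

theorem hitTime_zero_eq_one (hx : x ∉ H) : hitTime H 0 x ω = hitTime H 1 x ω := by
  rcases eq_or_ne (hitTime H 1 x ω) ⊤ with h' | h'
  · rw [h', hitTime_eq_top_iff]
    rw [hitTime_eq_top_iff] at h'
    rintro (_ | t) -
    exacts [hx, h' _ (by simp)]
  · obtain ⟨k, hk⟩ := ENat.ne_top_iff_exists.1 h'
    obtain ⟨h1, h2, h3⟩ := hitTime_eq_coe_iff.1 hk.symm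
    rw [← hk, hitTime_eq_coe_iff]
    refine ⟨Nat.zero_le _, h2, ?_⟩
    rintro (_ | t) - ht
    exacts [hx, h3 _ (by simp) ht]

/-- The bound `n + 1` excludes time zero, so it does not matter whether `x` itself lies in `H`. -/
theorem hitTime_consIncr (g : G) :
    hitTime H (n + 1) x (consIncr g ω) = hitTime H n (x * g) ω + 1 := by
  rcases eq_or_ne (hitTime H n (x * g) ω) ⊤ with h' | h'
  · rw [h', top_add, hitTime_eq_top_iff]
    rw [hitTime_eq_top_iff] at h'
    rintro (_ | t) ht
    · omega
    · rw [walk_consIncr]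
      exact h' t (by omega)
  · obtain ⟨k, hk⟩ := ENat.ne_top_iff_exists.1 h'
    obtain ⟨h1, h2, h3⟩ := hitTime_eq_coe_iff.1 hk.symm
    rw [← hk, show ((k : ℕ∞) + 1) = ((k + 1 : ℕ) : ℕ∞) by simp, hitTime_eq_coe_iff]
    refine ⟨by omega, by rwa [walk_consIncr], ?_⟩
    rintro (_ | t) hn ht
    · omega
    · rw [walk_consIncr]
      exact h3 t (by omega) (by omega)

/-- For an infinite hitting time the place is a convention that need not respect the identities
below; hence their finiteness hypotheses, which hold almost surely once the walk is known to return.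
-/
theorem coe_hitPlace {t : ℕ} (h : hitTime H n x ω = t) :
    (hitPlace H n x ω : G) = walk x t ω := by
  have h' : stoppedValue (walk x) (hitTime H n x) ω = walk x t ω := by
    simp only [stoppedValue, h]; rfl
  have hm : stoppedValue (walk x) (hitTime H n x) ω ∈ H := by
    rw [h']; exact (hitTime_eq_coe_iff.1 h).2.1
  rw [hitPlace, dif_pos hm]
  exact h'

theorem hitPlace_of_mem (hx : x ∈ H) : hitPlace H 0 x ω = ⟨x, hx⟩ :=
  Subtype.ext (coe_hitPlace (t := 0) (by simpa using hitTime_zero_of_mem hx))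

theorem hitPlace_zero_eq_one (hx : x ∉ H) (hτ : hitTime H 0 x ω ≠ ⊤) :
    hitPlace H 0 x ω = hitPlace H 1 x ω := by
  obtain ⟨k, hk⟩ := ENat.ne_top_iff_exists.1 hτ
  refine Subtype.ext ?_
  rw [coe_hitPlace hk.symm, coe_hitPlace (t := k) (by rw [← hitTime_zero_eq_one hx, hk])]

theorem hitPlace_left_mul (h : H) (hτ : hitTime H n x ω ≠ ⊤) :
    hitPlace H n (h * x) ω = h * hitPlace H n x ω := by
  obtain ⟨k, hk⟩ := ENat.ne_top_iff_exists.1 hτ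
  refine Subtype.ext ?_
  rw [coe_hitPlace (t := k) (by rw [hitTime_left_mul h.2, hk]), Subgroup.coe_mul,
    coe_hitPlace hk.symm, walk_left_mul]

theorem hitPlace_consIncr (g : G) (hτ : hitTime H n (x * g) ω ≠ ⊤) :
    hitPlace H (n + 1) x (consIncr g ω) = hitPlace H n (x * g) ω := by
  obtain ⟨k, hk⟩ := ENat.ne_top_iff_exists.1 hτ
  refine Subtype.ext ?_
  rw [coe_hitPlace (t := k + 1) (by rw [hitTime_consIncr, ← hk]; simp), coe_hitPlace hk.symm,
    walk_consIncr]

end Paths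

/-! ### Measurability of the walk, hitting times and hitting places -/

section Measurability

variable {G : Type*} [Group G] [Countable G] [MeasurableSpace G] [DiscreteMeasurableSpace G]

theorem measurable_walk (x : G) (t : ℕ) : Measurable (walk x t) := by
  induction t with
  | zero => exact measurable_const
  | succ t ih => exact ih.mul (measurable_pi_apply t)

theorem measurableSet_lt_hitTime (H : Subgroup G) (n : ℕ) (x : G) (t : ℕ) :
    MeasurableSet {ω | (t : ℕ∞) < hitTime H n x ω} := by
  simp only [coe_lt_hitTime_iff, Set.ofPred_forall]
  refine MeasurableSet.iInter fun s => MeasurableSet.iInter fun _ => MeasurableSet.iInter fun _ => ?_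
  exact measurable_walk x s (MeasurableSet.of_discrete (s := {y | y ∉ H}))

theorem measurable_hitTime (H : Subgroup G) (n : ℕ) (x : G) : Measurable (hitTime H n x) := by
  refine measurable_to_countable' fun y => ?_
  have key : ∀ s, MeasurableSet {ω : ℕ → G | walk x s ω ∉ H} := fun s =>
    measurable_walk x s (MeasurableSet.of_discrete (s := {y | y ∉ H}))
  rcases eq_or_ne y ⊤ with rfl | hy
  · have : hitTime H n x ⁻¹' {⊤} = ⋂ s, ⋂ (_ : n ≤ s), {ω : ℕ → G | walk x s ω ∉ H} := by
      ext ω; simp [hitTime_eq_top_iff]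
    rw [this]
    exact MeasurableSet.iInter fun s => MeasurableSet.iInter fun _ => key s
  · obtain ⟨k, rfl⟩ := ENat.ne_top_iff_exists.1 hy
    have : hitTime H n x ⁻¹' {(k : ℕ∞)} = {ω | n ≤ k} ∩ ({ω : ℕ → G | walk x k ω ∉ H}ᶜ ∩
        ⋂ s, ⋂ (_ : n ≤ s), ⋂ (_ : s < k), {ω : ℕ → G | walk x s ω ∉ H}) := by
      ext ω; simp [hitTime_eq_coe_iff]
    rw [this]
    exact (MeasurableSet.const _).inter ((key k).compl.inter (MeasurableSet.iInter fun s =>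
      MeasurableSet.iInter fun _ => MeasurableSet.iInter fun _ => key s))

theorem measurable_hitPlace (H : Subgroup G) (n : ℕ) (x : G) : Measurable (hitPlace H n x) := by
  classical
  have h1 : Measurable (stoppedValue (walk x) (hitTime H n x)) := by
    have h2 : Measurable fun p : ℕ × (ℕ → G) => walk x p.1 p.2 :=
      measurable_from_prod_countable_right fun t => measurable_walk x t
    have h3 : Measurable fun k : ℕ∞ => WithTop.untopA k := Measurable.of_discrete
    exact h2.comp ((h3.comp (measurable_hitTime H n x)).prodMk measurable_id)
  have h2 : Measurable fun y : G => if h : y ∈ H then (⟨y, h⟩ : H) else 1 :=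
    Measurable.of_discrete
  exact h2.comp h1

end Measurability

/-! ### The Markov property at time one -/

section OneStep

variable {G : Type*} [MeasurableSpace G] (μ : Measure G) [IsProbabilityMeasure μ]

instance isProbabilityMeasure_incrementLaw : IsProbabilityMeasure (incrementLaw μ) := by
  unfold incrementLaw; infer_instance

/-- A product measure is determined by its values on finite cylinders. -/
theorem measurePreserving_consIncr [DiscreteMeasurableSpace G] :
    MeasurePreserving (fun p : G × (ℕ → G) => consIncr p.1 p.2) (μ.prod (incrementLaw μ))
      (incrementLaw μ) := by
  refine ⟨measurable_consIncr, ?_⟩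
  refine Measure.eq_infinitePi _ fun s t ht => ?_
  classical
  obtain ⟨N, hN⟩ : ∃ N, s ⊆ Finset.range (N + 1) :=
    ⟨s.sup id, fun i hi => Finset.mem_range_succ_iff.2 (Finset.le_sup (f := id) hi)⟩
  -- Padding the cylinder with full factors up to an initial segment of times makes its preimage a
  -- rectangle: the first coordinate times a shifted cylinder.
  let t' : ℕ → Set G := fun i => if i ∈ s then t i else Set.univ
  have hpi : Set.pi (s : Set ℕ) t = Set.pi (Finset.range (N + 1) : Set ℕ) t' := by
    ext ω
    simp only [Set.mem_pi, t']
    refine ⟨fun h i _ => ?_, fun h i hi => ?_⟩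
    · split_ifs with hi
      exacts [h i hi, trivial]
    · have := h i (hN hi)
      rwa [if_pos (by exact hi)] at this
  have hprod : ∏ i ∈ s, μ (t i) = ∏ i ∈ Finset.range (N + 1), μ (t' i) := by
    rw [← Finset.prod_subset hN fun i _ hi => by simp [t', hi]]
    exact Finset.prod_congr rfl fun i hi => by simp [t', hi]
  have hpre : (fun p : G × (ℕ → G) => consIncr p.1 p.2) ⁻¹'
      (Set.pi (Finset.range (N + 1) : Set ℕ) t') =
      t' 0 ×ˢ Set.pi (Finset.range N : Set ℕ) fun i => t' (i + 1) := by
    ext ⟨g, ω⟩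
    simp only [Set.mem_preimage, Set.mem_pi, Set.mem_prod, Finset.coe_range, Set.mem_Iio]
    constructor
    · exact fun h => ⟨h 0 (by omega), fun i hi => h (i + 1) (by omega)⟩
    · rintro ⟨h0, h⟩ (_ | i) hi
      exacts [h0, h i (by omega)]
  rw [hpi, hprod, Measure.map_apply measurable_consIncr
    (MeasurableSet.pi (Finset.countable_toSet _) fun _ _ => MeasurableSet.of_discrete), hpre,
    Measure.prod_prod, incrementLaw, Measure.infinitePi_pi _ fun _ _ => MeasurableSet.of_discrete,
    Finset.prod_range_succ', mul_comm]

variable [DiscreteMeasurableSpace G]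

theorem lintegral_incrementLaw {Φ : (ℕ → G) → ℝ≥0∞} (hΦ : Measurable Φ) :
    ∫⁻ ω, Φ ω ∂(incrementLaw μ) = ∫⁻ g, ∫⁻ ω, Φ (consIncr g ω) ∂(incrementLaw μ) ∂μ := by
  rw [← (measurePreserving_consIncr μ).lintegral_comp hΦ,
    lintegral_prod (fun p : G × (ℕ → G) => Φ (consIncr p.1 p.2))
      (hΦ.comp measurable_consIncr).aemeasurable]

theorem integral_incrementLaw {Φ : (ℕ → G) → ℂ} (hΦ : Measurable Φ)
    (hi : Integrable Φ (incrementLaw μ)) :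
    ∫ ω, Φ ω ∂(incrementLaw μ) = ∫ g, ∫ ω, Φ (consIncr g ω) ∂(incrementLaw μ) ∂μ := by
  have h := measurePreserving_consIncr μ
  rw [← h.map_eq, integral_map h.aemeasurable hΦ.aestronglyMeasurable, h.map_eq,
    integral_prod (fun p : G × (ℕ → G) => Φ (consIncr p.1 p.2))
      (h.integrable_comp_of_integrable hi)]

end OneStep

/-! ### Consequences of adaptedness -/

section Adapted

variable {G : Type*} [Group G] [MeasurableSpace G] {μ : Measure G}

theorem IsAdapted.exists_list_prod (hμ : IsAdapted μ) (g : G) :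
    ∃ l : List G, (∀ s ∈ l, μ {s} ≠ 0) ∧ l.prod = g := by
  refine Submonoid.exists_list_of_mem_closure (s := {g : G | μ {g} ≠ 0}) ?_
  have hle : Subsemigroup.closure {g : G | μ {g} ≠ 0} ≤
      (Submonoid.closure {g : G | μ {g} ≠ 0}).toSubsemigroup :=
    Subsemigroup.closure_le.2 Submonoid.subset_closure
  exact hle (by rw [hμ]; trivial)

theorem IsAdapted.exists_ne_zero (hμ : IsAdapted μ) : ∃ g, μ {g} ≠ 0 := by
  by_contra! h
  have h1 : (1 : G) ∈ Subsemigroup.closure {g : G | μ {g} ≠ 0} := by rw [hμ]; trivial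
  have h2 : {g : G | μ {g} ≠ 0} = ∅ := by ext g; simp [h g]
  rw [h2, Subsemigroup.closure_empty] at h1
  exact h1

end Adapted

/-! ### Uniform tail bounds for the hitting time -/

section HitTail

theorem natCast_succ_lt_hitTime_consIncr {G : Type*} [Group G] {H : Subgroup G} {x g : G} {ω : ℕ → G} (hx : x ∉ H) (n : ℕ) :
    ((n + 1 : ℕ) : ℕ∞) < hitTime H 0 x (consIncr g ω) ↔ (n : ℕ∞) < hitTime H 0 (x * g) ω := by
  rw [hitTime_zero_eq_one hx, hitTime_consIncr, Nat.cast_succ]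
  exact ENat.add_lt_add_iff_right ENat.one_ne_top

variable {G : Type*} [Group G] [MeasurableSpace G]

/-- The probability `ℙ_x(τ > n)`. -/
noncomputable def hitTail (H : Subgroup G) (μ : Measure G) (x : G) (n : ℕ) : ℝ≥0∞ :=
  incrementLaw μ {ω | (n : ℕ∞) < hitTime H 0 x ω}

variable {H : Subgroup G} {μ : Measure G}

theorem hitTail_of_mem {x : G} (hx : x ∈ H) (n : ℕ) : hitTail H μ x n = 0 := by
  simp [hitTail, hitTime_zero_of_mem hx]

theorem hitTail_left_mul {h : G} (hh : h ∈ H) (x : G) (n : ℕ) :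
    hitTail H μ (h * x) n = hitTail H μ x n := by
  simp only [hitTail, hitTime_left_mul hh]

theorem hitTail_anti (x : G) : Antitone (hitTail H μ x) := fun m n hmn =>
  measure_mono fun ω (hω : (n : ℕ∞) < _) => lt_of_le_of_lt (by exact_mod_cast hmn) hω

theorem expectedHitTime_left_mul {h : G} (hh : h ∈ H) (x : G) :
    expectedHitTime H μ (h * x) = expectedHitTime H μ x := by
  simp only [expectedHitTime, hitTime_left_mul hh]

variable [IsProbabilityMeasure μ]

theorem hitTail_le_one (x : G) (n : ℕ) : hitTail H μ x n ≤ 1 := prob_le_one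

theorem hitTail_zero_of_notMem {x : G} (hx : x ∉ H) : hitTail H μ x 0 = 1 := by
  rw [hitTail]
  convert measure_univ (μ := incrementLaw μ)
  ext ω
  simp only [coe_lt_hitTime_iff, Set.mem_ofPred_eq, Set.mem_univ, iff_true]
  intro s _ hs
  obtain rfl : s = 0 := by omega
  exact hx

variable [Countable G] [DiscreteMeasurableSpace G]

theorem hitTail_succ {x : G} (hx : x ∉ H) (n : ℕ) :
    hitTail H μ x (n + 1) = ∫⁻ g, hitTail H μ (x * g) n ∂μ := by
  simp only [hitTail]
  rw [← lintegral_indicator_one (measurableSet_lt_hitTime H 0 x (n + 1)),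
    lintegral_incrementLaw μ (measurable_one.indicator (measurableSet_lt_hitTime H 0 x (n + 1)))]
  refine lintegral_congr fun g => ?_
  rw [← lintegral_indicator_one (measurableSet_lt_hitTime H 0 (x * g) n)]
  refine lintegral_congr fun ω => ?_
  simp only [Set.indicator, Set.mem_ofPred_eq, natCast_succ_lt_hitTime_consIncr hx, Pi.one_apply]

/-- Adaptedness supplies a word of increments of positive mass leading from `x` to the identity; the
induction follows it until it enters `H`. -/
theorem exists_hitTail_lt_one (hμ : IsAdapted μ) (x : G) : ∃ n, hitTail H μ x n < 1 := by
  obtain ⟨l, hl, hx⟩ := hμ.exists_list_prod x⁻¹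
  replace hx : x * l.prod ∈ H := by rw [hx, mul_inv_cancel]; exact H.one_mem
  induction l generalizing x with
  | nil => exact ⟨0, by rw [hitTail_of_mem (by simpa using hx)]; exact one_pos⟩
  | cons s l ih =>
    by_cases hxH : x ∈ H
    · exact ⟨0, by rw [hitTail_of_mem hxH]; exact one_pos⟩
    obtain ⟨n, hn⟩ := ih (x * s) (fun a ha => hl a (by simp [ha]))
      (by rwa [mul_assoc, ← List.prod_cons])
    refine ⟨n + 1, lt_of_le_of_ne (hitTail_le_one _ _) fun h1 => hn.ne ?_⟩
    rw [hitTail_succ hxH] at h1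
    -- An average of quantities at most 1 equals 1 only if almost all of them are 1; the atom `s`
    -- forbids this.
    have hae : (fun g => hitTail H μ (x * g) n) =ᵐ[μ] fun _ => 1 :=
      ae_eq_of_ae_le_of_lintegral_le (ae_of_all _ fun g => hitTail_le_one _ _) (by simp [h1])
        aemeasurable_const (by simp [h1])
    by_contra hne
    exact hl s (by simp) (measure_mono_null (by simpa using hne) hae)

/-- Tails are constant on cosets `Hx` and decrease in time, so maxima over finitely many
representatives suffice. -/
theorem exists_hitTail_le [H.FiniteIndex] (hμ : IsAdapted μ) :
    ∃ N, ∃ a < 1, ∀ x, hitTail H μ x N ≤ a := by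
  obtain ⟨F, hF, -⟩ := exists_finset_isComplement H
  choose n hn using fun x => exists_hitTail_lt_one (H := H) hμ x
  refine ⟨F.sup n, F.sup fun g => hitTail H μ g (n g), ?_, fun x => ?_⟩
  · exact (Finset.sup_lt_iff (by simp)).2 fun g _ => hn g
  · obtain ⟨h, g, hg, rfl⟩ := exists_mul_eq hF x
    rw [hitTail_left_mul h.2]
    exact (hitTail_anti g (Finset.le_sup hg)).trans
      (Finset.le_sup (f := fun g => hitTail H μ g (n g)) hg)

/-- A walk that has not hit by time `n` restarts, and `a` bounds its next `N` steps from any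
position. -/
theorem hitTail_add_le {N : ℕ} {a : ℝ≥0∞} (ha : ∀ x, hitTail H μ x N ≤ a) (n : ℕ) (x : G) :
    hitTail H μ x (n + N) ≤ a * hitTail H μ x n := by
  by_cases hx : x ∈ H
  · simp [hitTail_of_mem hx]
  induction n generalizing x with
  | zero => simpa [hitTail_zero_of_notMem hx] using ha x
  | succ n ih =>
    rw [Nat.add_right_comm, hitTail_succ hx, hitTail_succ hx,
      ← lintegral_const_mul _ Measurable.of_discrete]
    refine lintegral_mono fun g => ?_
    by_cases hg : x * g ∈ H
    · simp [hitTail_of_mem hg]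
    · exact ih _ hg

/-- Splitting off the first `N` terms, each at most 1, gives `s ≤ N + a s` for the partial sum `s`;
as `s` is finite, this can be solved for `s`. -/
theorem sum_hitTail_le {N : ℕ} {a : ℝ≥0∞} (ha1 : a < 1) (ha : ∀ x, hitTail H μ x N ≤ a) (m : ℕ)
    (x : G) : ∑ n ∈ Finset.range m, hitTail H μ x n ≤ N / (1 - a) := by
  have h1 : ∑ n ∈ Finset.range m, hitTail H μ x n ≤
      N + a * ∑ n ∈ Finset.range m, hitTail H μ x n := by
    calc ∑ n ∈ Finset.range m, hitTail H μ x n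
        ≤ ∑ n ∈ Finset.range (N + m), hitTail H μ x n :=
          Finset.sum_le_sum_of_subset (Finset.range_mono (by omega))
      _ = ∑ n ∈ Finset.range N, hitTail H μ x n
          + ∑ n ∈ Finset.range m, hitTail H μ x (N + n) := Finset.sum_range_add ..
      _ ≤ _ := by
        gcongr
        · exact (Finset.sum_le_sum fun n _ => hitTail_le_one x n).trans (by simp)
        · rw [Finset.mul_sum]
          exact Finset.sum_le_sum fun n _ => by
            rw [add_comm]; exact hitTail_add_le ha n x
  have hfin : ∑ n ∈ Finset.range m, hitTail H μ x n ≠ ∞ :=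
    ENNReal.sum_ne_top.2 fun n _ => ((hitTail_le_one x n).trans_lt ENNReal.one_lt_top).ne
  rw [ENNReal.le_div_iff_mul_le (Or.inl (tsub_pos_of_lt ha1).ne') (Or.inl (by simp)), mul_comm,
    ENNReal.sub_mul fun _ _ => hfin, one_mul]
  exact tsub_le_iff_right.2 h1

theorem natCast_toENNReal_eq_tsum (a : ℕ∞) :
    (a : ℝ≥0∞) = ∑' n : ℕ, if (n : ℕ∞) < a then 1 else 0 := by
  induction a using ENat.recTopCoe with
  | top => simp
  | coe k =>
    rw [tsum_eq_sum (s := Finset.range k) fun n hn => by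
      simpa using Finset.mem_range.not.1 hn]
    simp only [Nat.cast_lt, ← Finset.sum_filter]
    rw [Finset.filter_true_of_mem fun n hn => Finset.mem_range.1 hn]
    simp

omit [IsProbabilityMeasure μ] in
theorem expectedHitTime_eq_tsum (x : G) :
    expectedHitTime H μ x = ∑' n, hitTail H μ x n := by
  simp only [expectedHitTime, natCast_toENNReal_eq_tsum, hitTail]
  rw [lintegral_tsum fun n => (Measurable.ite (measurableSet_lt_hitTime H 0 x n)
    measurable_const measurable_const).aemeasurable]
  refine tsum_congr fun n => ?_
  rw [← lintegral_indicator_one (measurableSet_lt_hitTime H 0 x n)]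
  simp [Set.indicator]

theorem iSup_expectedHitTime_lt_top [H.FiniteIndex] (hμ : IsAdapted μ) :
    ⨆ x, expectedHitTime H μ x < ∞ := by
  obtain ⟨N, a, ha1, ha⟩ := exists_hitTail_le (H := H) hμ
  refine lt_of_le_of_lt (b := (N : ℝ≥0∞) / (1 - a)) (iSup_le fun x => ?_)
    (ENNReal.div_lt_top (by simp) (tsub_pos_of_lt ha1).ne')
  rw [expectedHitTime_eq_tsum]
  exact ENNReal.tsum_le_of_sum_range_le fun m => sum_hitTail_le ha1 ha m x

theorem ae_hitTime_ne_top [H.FiniteIndex] (hμ : IsAdapted μ) (x : G) :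
    ∀ᵐ ω ∂(incrementLaw μ), hitTime H 0 x ω ≠ ⊤ := by
  have h : ∫⁻ ω, (hitTime H 0 x ω : ℝ≥0∞) ∂(incrementLaw μ) ≠ ∞ :=
    ((le_iSup (expectedHitTime H μ) x).trans_lt (iSup_expectedHitTime_lt_top hμ)).ne
  have hm : Measurable fun ω => (hitTime H 0 x ω : ℝ≥0∞) :=
    (Measurable.of_discrete (f := fun a : ℕ∞ => (a : ℝ≥0∞))).comp (measurable_hitTime H 0 x)
  filter_upwards [ae_lt_top hm h] with ω hω h'
  simp [h'] at hω

theorem ae_hitTime_one_ne_top [H.FiniteIndex] (hμ : IsAdapted μ) (x : G) :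
    ∀ᵐ ω ∂(incrementLaw μ), hitTime H 1 x ω ≠ ⊤ := by
  have hms : MeasurableSet {ω | hitTime H 1 x ω = ⊤} :=
    measurable_hitTime H 1 x (MeasurableSet.singleton _)
  rw [ae_iff]
  simp only [not_not]
  rw [← lintegral_indicator_one hms, lintegral_incrementLaw μ (measurable_one.indicator hms)]
  refine (lintegral_congr fun g => ?_).trans lintegral_zero
  refine lintegral_eq_zero_of_ae_eq_zero ?_
  filter_upwards [ae_hitTime_ne_top (H := H) hμ (x * g)] with ω hω
  simp [hitTime_consIncr (n := 0), hω]

end HitTail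

/-! ### Wald's identity for the path up to the hitting time -/

section PathLength

variable {G : Type*} [Group G]

/-- The word length of the path up to the hitting time of `H`. -/
noncomputable def pathLength (S : Finset G) (H : Subgroup G) (x : G) (ω : ℕ → G) : ℝ≥0∞ :=
  ∑' t : ℕ, {ω : ℕ → G | (t : ℕ∞) < hitTime H 0 x ω}.indicator
    (fun ω => (wordLength S (ω t) : ℝ≥0∞)) ω

variable {S : Finset G} {H : Subgroup G}

theorem wordLength_inv_mul_hitPlace_le (hS : IsSymmGen S) {x : G} {ω : ℕ → G}
    (hτ : hitTime H 0 x ω ≠ ⊤) :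
    (wordLength S (x⁻¹ * hitPlace H 0 x ω) : ℝ≥0∞) ≤ pathLength S H x ω := by
  obtain ⟨k, hk⟩ := ENat.ne_top_iff_exists.1 hτ
  rw [coe_hitPlace hk.symm]
  refine le_trans ?_ (ENNReal.sum_le_tsum (Finset.range k))
  refine le_trans (b := ((∑ i ∈ Finset.range k, wordLength S (ω i) : ℕ) : ℝ≥0∞))
    (by exact_mod_cast wordLength_inv_mul_walk_le hS x k ω) ?_
  rw [Nat.cast_sum]
  refine Finset.sum_le_sum fun i hi => ?_
  rw [Set.indicator_of_mem]
  rw [Set.mem_ofPred_eq, ← hk]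
  exact_mod_cast Finset.mem_range.1 hi

variable [Countable G] [MeasurableSpace G] [DiscreteMeasurableSpace G]

theorem measurable_indicator_wordLength (S : Finset G) (H : Subgroup G) (x : G) (t : ℕ) :
    Measurable ({ω : ℕ → G | (t : ℕ∞) < hitTime H 0 x ω}.indicator
      fun ω => (wordLength S (ω t) : ℝ≥0∞)) :=
  ((Measurable.of_discrete (f := fun g : G => (wordLength S g : ℝ≥0∞))).comp
    (measurable_pi_apply t)).indicator (measurableSet_lt_hitTime H 0 x t)

variable {μ : Measure G} [IsProbabilityMeasure μ]

/-- The event τ > t is decided by the increments before `ω t`, hence is independent of `ω t`. The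
proof obtains this by induction on first steps. -/
theorem lintegral_indicator_wordLength (x : G) (t : ℕ) :
    ∫⁻ ω, {ω : ℕ → G | (t : ℕ∞) < hitTime H 0 x ω}.indicator
      (fun ω => (wordLength S (ω t) : ℝ≥0∞)) ω ∂(incrementLaw μ) =
      firstMoment S μ * hitTail H μ x t := by
  by_cases hx : x ∈ H
  · simp [hitTail_of_mem hx, hitTime_zero_of_mem hx]
  rw [lintegral_incrementLaw μ (measurable_indicator_wordLength S H x t)]
  induction t generalizing x with
  | zero =>
    have h0 : ∀ ω, ((0 : ℕ) : ℕ∞) < hitTime H 0 x ω := fun ω =>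
      coe_lt_hitTime_iff.2 fun s _ hs => by
        obtain rfl : s = 0 := by omega
        exact hx
    simp only [Set.indicator, Set.mem_ofPred_eq, h0, if_true, consIncr_zero,
      hitTail_zero_of_notMem hx, mul_one, firstMoment, lintegral_const, measure_univ]
  | succ t ih =>
    rw [hitTail_succ hx, ← lintegral_const_mul _ Measurable.of_discrete]
    refine lintegral_congr fun g => ?_
    simp only [Set.indicator, Set.mem_ofPred_eq, natCast_succ_lt_hitTime_consIncr hx,
      consIncr_succ]
    by_cases hg : x * g ∈ H
    · simp [hitTail_of_mem hg, hitTime_zero_of_mem hg]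
    rw [← ih _ hg, ← lintegral_incrementLaw μ (measurable_indicator_wordLength S H (x * g) t)]
    simp [Set.indicator]

/-- Wald's identity for the length of the path up to the hitting time. -/
theorem lintegral_pathLength (x : G) :
    ∫⁻ ω, pathLength S H x ω ∂(incrementLaw μ) = firstMoment S μ * expectedHitTime H μ x := by
  simp only [pathLength]
  rw [lintegral_tsum fun t => (measurable_indicator_wordLength S H x t).aemeasurable,
    expectedHitTime_eq_tsum, ← ENNReal.tsum_mul_left]
  exact tsum_congr fun t => lintegral_indicator_wordLength x t

/-- The displacement from `h` is `g` followed by the displacement from `h * g`, and the expected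
hitting time from `h * g` does not depend on `h`. -/
theorem lintegral_wordLength_hitPlace_le [H.FiniteIndex] (hμ : IsAdapted μ) (hS : IsSymmGen S)
    (h : H) (g : G) :
    ∫⁻ ω, (wordLength S ((h : G)⁻¹ * hitPlace H 0 (h * g) ω) : ℝ≥0∞) ∂(incrementLaw μ) ≤
      wordLength S g + firstMoment S μ * expectedHitTime H μ g := by
  have h1 : ∀ᵐ ω ∂(incrementLaw μ),
      (wordLength S ((h : G)⁻¹ * hitPlace H 0 (h * g) ω) : ℝ≥0∞) ≤
        wordLength S g + pathLength S H (h * g) ω := by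
    filter_upwards [ae_hitTime_ne_top (H := H) hμ (h * g)] with ω hω
    have : (h : G)⁻¹ * hitPlace H 0 (h * g) ω =
        g * ((h * g)⁻¹ * hitPlace H 0 (h * g) ω) := by group
    rw [this]
    refine le_trans ?_ (add_le_add le_rfl (wordLength_inv_mul_hitPlace_le hS hω))
    exact_mod_cast hS.wordLength_mul_le _ _
  refine (lintegral_mono_ae h1).trans ?_
  rw [lintegral_add_left measurable_const, lintegral_pathLength, lintegral_const, measure_univ,
    mul_one, expectedHitTime_left_mul h.2]

end PathLength

/-! ### Finite first moment -/

section FirstMoment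

theorem lintegral_ne_zero_of_singleton {G : Type*} [MeasurableSpace G] {μ : Measure G} {F : G → ℝ≥0∞} [DiscreteMeasurableSpace G]
    {s : G} (hs : μ {s} ≠ 0) (hF : F s ≠ 0) : ∫⁻ g, F g ∂μ ≠ 0 := by
  intro h
  rw [lintegral_eq_zero_iff Measurable.of_discrete] at h
  exact hs (measure_mono_null (by simpa using hF) h)

variable {G : Type*} [Group G] [MeasurableSpace G]

/-- `μ` has finite first moment with respect to word lengths. -/
def HasFirstMoment (μ : Measure G) : Prop :=
  ∀ S : Finset G, IsSymmGen S → firstMoment S μ < ∞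

variable {μ : Measure G} [DiscreteMeasurableSpace G]

theorem hasFirstMoment_of_lt_top {S : Finset G} (hS : IsSymmGen S) (h : firstMoment S μ < ∞) :
    HasFirstMoment μ := by
  intro T hT
  obtain ⟨C, hC⟩ := hS.exists_wordLength_le_mul hT
  refine lt_of_le_of_lt (b := (C : ℝ≥0∞) * firstMoment S μ) ?_ (ENNReal.mul_lt_top (by simp) h)
  rw [firstMoment, firstMoment, ← lintegral_const_mul _ Measurable.of_discrete]
  exact lintegral_mono fun g => by dsimp only; exact_mod_cast hC g

/-- From `ζ n ≤ exp (ζ n)`. Smoothness is used nowhere else, so only first moments have to be passed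
on to hitting laws. -/
theorem IsSmooth.hasFirstMoment (hμ : IsSmooth μ) : HasFirstMoment μ := by
  obtain ⟨S, hS, ζ, hζ, h⟩ := hμ
  refine hasFirstMoment_of_lt_top hS (lt_of_le_of_lt (b := ENNReal.ofReal ζ⁻¹ * _) ?_
    (ENNReal.mul_lt_top ENNReal.ofReal_lt_top h))
  rw [firstMoment, ← lintegral_const_mul _ Measurable.of_discrete]
  refine lintegral_mono fun g => ?_
  rw [← ENNReal.ofReal_mul (by positivity), ← ENNReal.ofReal_natCast]
  refine ENNReal.ofReal_le_ofReal ?_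
  rw [← mul_le_mul_iff_of_pos_left hζ, ← mul_assoc, mul_inv_cancel₀ hζ.ne', one_mul]
  linarith [Real.add_one_le_exp (ζ * wordLength S g)]

variable [IsProbabilityMeasure μ] [Group.FG G]

/-- The increment `f (x * g) - f x` is at most linear in the length of `g`, so absolute convergence
in harmonicity is automatic. -/
theorem IsLipschitz.integrable (hμ : HasFirstMoment μ) {f : G → ℂ} (hf : IsLipschitz f) (x : G) :
    Integrable (fun g => f (x * g)) μ := by
  have := countable_of_fg G
  obtain ⟨S, hS⟩ := exists_isSymmGen G
  have h : Integrable (fun g => f (x * g) - f x) μ := by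
    refine ⟨Measurable.of_discrete.aestronglyMeasurable, ?_⟩
    refine lt_of_le_of_lt (lintegral_mono fun g => hS.enorm_sub_le f x g) ?_
    rw [lintegral_mul_const _ Measurable.of_discrete]
    exact ENNReal.mul_lt_top (hμ S hS) (hf S hS)
  exact (h.add (integrable_const (f x))).congr (ae_of_all _ fun g => by simp)

end FirstMoment

/-! ### Harmonic induction, the hitting law and the Dirichlet problem -/

section Induction

variable {G : Type*} [Group G] [MeasurableSpace G]

theorem ind_coe {H : Subgroup G} {μ : Measure G} [IsProbabilityMeasure μ] (f : H → ℂ) (h : H) :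
    ind H μ f h = f h := by
  simp [ind, hitPlace_of_mem h.2]

variable [Countable G] [DiscreteMeasurableSpace G]

theorem measurable_comp_hitPlace {H : Subgroup G} {E : Type*} [MeasurableSpace E] (f : H → E) (n : ℕ) (x : G) :
    Measurable fun ω => f (hitPlace H n x ω) :=
  Measurable.of_discrete.comp (measurable_hitPlace H n x)

variable {H : Subgroup G} [H.FiniteIndex] {μ : Measure G} [IsProbabilityMeasure μ]

theorem lintegral_enorm_sub_hitPlace_le (hμ : IsAdapted μ) {S : Finset G} (hS : IsSymmGen S)
    {T : Finset H} (hT : IsSymmGen T) {A : ℝ≥0}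
    (hA : ∀ h : H, (wordLength T h : ℝ≥0) ≤ A * wordLength S (h : G)) (f : H → ℂ)
    (h : H) (g : G) :
    ∫⁻ ω, ‖f (hitPlace H 0 (h * g) ω) - f h‖ₑ ∂(incrementLaw μ) ≤
      A * (wordLength S g + firstMoment S μ * expectedHitTime H μ g) * gradNorm T f := by
  have hb : ∀ ω, ‖f (hitPlace H 0 (h * g) ω) - f h‖ₑ ≤
      (A * gradNorm T f) * (wordLength S ((h : G)⁻¹ * hitPlace H 0 (h * g) ω) : ℝ≥0∞) := by
    intro ω
    have h1 := hT.enorm_sub_le f h (h⁻¹ * hitPlace H 0 (h * g) ω)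
    rw [mul_inv_cancel_left] at h1
    refine h1.trans ?_
    rw [mul_right_comm]
    gcongr
    exact_mod_cast hA (h⁻¹ * hitPlace H 0 (h * g) ω)
  refine (lintegral_mono hb).trans ?_
  rw [lintegral_const_mul _ (measurable_comp_hitPlace
    (fun y : H => (wordLength S ((h : G)⁻¹ * y) : ℝ≥0∞)) 0 (h * g)), mul_right_comm _ _ (gradNorm T f)]
  gcongr
  exact lintegral_wordLength_hitPlace_le hμ hS h g

variable [Group.FG G]

theorem exists_bound_enorm_sub_hitPlace (hμ : IsAdapted μ) (hμ1 : HasFirstMoment μ)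
    {S : Finset G} (hS : IsSymmGen S) {f : H → ℂ} (hf : IsLipschitz f) :
    ∃ C : ℝ≥0, ∀ (h : H) (g : G), ∫⁻ ω, ‖f (hitPlace H 0 (h * g) ω) - f h‖ₑ ∂(incrementLaw μ) ≤
      C * (wordLength S g + C) := by
  obtain ⟨T, hT⟩ := exists_isSymmGen H
  obtain ⟨A, hA⟩ := exists_wordLength_subgroup_le hS hT
  have hfin := ENNReal.mul_lt_top (hμ1 S hS) (iSup_expectedHitTime_lt_top (H := H) hμ)
  refine ⟨max (A * (gradNorm T f).toNNReal)
    (firstMoment S μ * ⨆ x, expectedHitTime H μ x).toNNReal, fun h g => ?_⟩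
  refine (lintegral_enorm_sub_hitPlace_le hμ hS hT (A := A)
    (fun h => by exact_mod_cast hA h) f h g).trans ?_
  rw [mul_right_comm]
  gcongr
  · rw [← ENNReal.coe_toNNReal (hf T hT).ne, ← ENNReal.coe_mul]
    exact ENNReal.coe_le_coe.2 (le_max_left _ _)
  · refine le_trans ?_ (ENNReal.coe_le_coe.2 (le_max_right _ _))
    rw [ENNReal.coe_toNNReal hfin.ne]
    gcongr
    exact le_iSup (expectedHitTime H μ) g

theorem integrable_comp_hitPlace (hμ : IsAdapted μ) (hμ1 : HasFirstMoment μ) {f : H → ℂ}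
    (hf : IsLipschitz f) (x : G) :
    Integrable (fun ω => f (hitPlace H 0 x ω)) (incrementLaw μ) := by
  obtain ⟨S, hS⟩ := exists_isSymmGen G
  obtain ⟨C, hC⟩ := exists_bound_enorm_sub_hitPlace hμ hμ1 hS hf
  have h : Integrable (fun ω => f (hitPlace H 0 x ω) - f 1) (incrementLaw μ) := by
    refine ⟨(measurable_comp_hitPlace (fun y => f y - f 1) 0 x).aestronglyMeasurable, ?_⟩
    have := hC 1 x
    rw [Subgroup.coe_one, one_mul] at this
    exact this.trans_lt (ENNReal.mul_lt_top ENNReal.coe_lt_top (by simp))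
  exact (h.add (integrable_const (f 1))).congr (ae_of_all _ fun ω => by simp)

theorem enorm_ind_sub_le (hμ : IsAdapted μ) (hμ1 : HasFirstMoment μ) {S : Finset G}
    (hS : IsSymmGen S) {T : Finset H} (hT : IsSymmGen T) {A : ℝ≥0}
    (hA : ∀ h : H, (wordLength T h : ℝ≥0) ≤ A * wordLength S (h : G)) {f : H → ℂ}
    (hf : IsLipschitz f) (h : H) (g : G) :
    ‖ind H μ f (h * g) - f h‖ₑ ≤
      A * (wordLength S g + firstMoment S μ * expectedHitTime H μ g) * gradNorm T f := by
  refine le_trans ?_ (lintegral_enorm_sub_hitPlace_le hμ hS hT hA f h g)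
  have : ind H μ f (h * g) - f h =
      ∫ ω, (f (hitPlace H 0 (h * g) ω) - f h) ∂(incrementLaw μ) := by
    rw [integral_sub (integrable_comp_hitPlace hμ hμ1 hf _) (integrable_const _)]
    simp [ind]
  rw [this]
  exact enorm_integral_le_lintegral_enorm _

/-- Write `x = h g` and `x s = h' g'` with `g, g' ∈ F`. Replacing the induced function by `f h` and
`f h'` costs A(D + m₁T) each, and passing from `h` to `h'` costs A(2D + 1), all times the seminorm
of `f`; the sum is C_*. -/
theorem gradNorm_ind_le (hμ : IsAdapted μ) (hμ1 : HasFirstMoment μ) {S : Finset G}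
    (hS : IsSymmGen S) {T : Finset H} (hT : IsSymmGen T) {A : ℝ≥0}
    (hA : ∀ h : H, (wordLength T h : ℝ≥0) ≤ A * wordLength S (h : G))
    {F : Finset G} (hF : Subgroup.IsComplement (H : Set G) (F : Set G)) {f : H → ℂ}
    (hf : IsLipschitz f) :
    gradNorm S (ind H μ f) ≤
      (A : ℝ≥0∞) * ((4 * ((F.sup fun g => wordLength S g : ℕ) : ℝ≥0∞) + 1)
        + 2 * firstMoment S μ * ⨆ x : G, expectedHitTime H μ x) * gradNorm T f := by
  refine gradNorm_le_iff.2 fun s hs x => ?_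
  set D : ℕ := F.sup fun g => wordLength S g with hD
  obtain ⟨h, g, hg, hx⟩ := exists_mul_eq hF x
  obtain ⟨h', g', hg', hx'⟩ := exists_mul_eq hF (x * s)
  have hgD : wordLength S g ≤ D := Finset.le_sup (f := fun g => wordLength S g) hg
  have hgD' : wordLength S g' ≤ D := Finset.le_sup (f := fun g => wordLength S g) hg'
  have hE : ∀ (h : H) (g : G), wordLength S g ≤ D → ‖ind H μ f (h * g) - f h‖ₑ ≤
      A * (D + firstMoment S μ * ⨆ x, expectedHitTime H μ x) * gradNorm T f := by
    intro h g hg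
    refine (enorm_ind_sub_le hμ hμ1 hS hT hA hf h g).trans ?_
    gcongr
    exact le_iSup (expectedHitTime H μ) g
  have hmid : ‖f h' - f h‖ₑ ≤ A * (2 * D + 1) * gradNorm T f := by
    have h1 := hT.enorm_sub_le f h (h⁻¹ * h')
    rw [mul_inv_cancel_left] at h1
    refine h1.trans ?_
    gcongr
    -- The `H`-parts differ by a word of length at most D + 1 + D.
    have h2 : ((h⁻¹ * h' : H) : G) = g * s * g'⁻¹ := by
      rw [Subgroup.coe_mul, Subgroup.coe_inv, eq_mul_inv_iff_mul_eq, mul_assoc, hx', ← hx]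
      group
    have h3 : wordLength S ((h⁻¹ * h' : H) : G) ≤ 2 * D + 1 := by
      rw [h2]
      have h4 := hS.wordLength_mul_le (g * s) g'⁻¹
      have h5 := hS.wordLength_mul_le g s
      have h6 := hS.wordLength_inv_le g'
      have h7 := wordLength_le_one hs
      omega
    have h8 : (wordLength T (h⁻¹ * h') : ℝ≥0) ≤ A * (2 * D + 1) := by
      refine (hA _).trans ?_
      gcongr
      exact_mod_cast h3
    exact_mod_cast h8
  have hsplit : ind H μ f (x * s) - ind H μ f x =
      (ind H μ f (h' * g') - f h') + (f h' - f h) - (ind H μ f (h * g) - f h) := by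
    rw [hx, hx']; ring
  rw [hsplit]
  refine (enorm_sub_le.trans (add_le_add ((enorm_add_le _ _).trans
    (add_le_add (hE h' g' hgD') hmid)) (hE h g hgD))).trans (le_of_eq ?_)
  ring

theorem isLipschitz_ind (hμ : IsAdapted μ) (hμ1 : HasFirstMoment μ) {f : H → ℂ}
    (hf : IsLipschitz f) : IsLipschitz (ind H μ f) := by
  intro S hS
  obtain ⟨T, hT⟩ := exists_isSymmGen H
  obtain ⟨A, hA⟩ := exists_wordLength_subgroup_le hS hT
  obtain ⟨F, hF, -⟩ := exists_finset_isComplement H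
  refine (gradNorm_ind_le hμ hμ1 hS hT (A := A) (fun h => by exact_mod_cast hA h) hF hf).trans_lt ?_
  have hT' := iSup_expectedHitTime_lt_top (H := H) hμ
  have hS' := hμ1 S hS
  have hf' := hf T hT
  refine ENNReal.mul_lt_top (ENNReal.mul_lt_top (by simp) (ENNReal.add_lt_top.2 ⟨?_, ?_⟩)) hf'
  · exact ENNReal.add_lt_top.2 ⟨ENNReal.mul_lt_top (by simp) (by simp), by simp⟩
  · exact ENNReal.mul_lt_top (ENNReal.mul_lt_top (by simp) hS') hT'

omit [Group.FG G] in
theorem ae_hitPlace_consIncr (hμ : IsAdapted μ) {x : G} (hx : x ∉ H) (g : G) :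
    ∀ᵐ ω ∂(incrementLaw μ), hitPlace H 0 x (consIncr g ω) = hitPlace H 0 (x * g) ω := by
  filter_upwards [ae_hitTime_ne_top (H := H) hμ (x * g)] with ω hω
  have h : hitTime H 0 x (consIncr g ω) ≠ ⊤ := by
    rw [hitTime_zero_eq_one hx, hitTime_consIncr]
    simpa using hω
  rw [hitPlace_zero_eq_one hx h, hitPlace_consIncr g hω]

theorem ind_eq_integral (hμ : IsAdapted μ) (hμ1 : HasFirstMoment μ) {f : H → ℂ}
    (hf : IsLipschitz f) {x : G} (hx : x ∉ H) :
    ind H μ f x = ∫ g, ind H μ f (x * g) ∂μ := by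
  rw [ind, integral_incrementLaw μ (measurable_comp_hitPlace f 0 x)
    (integrable_comp_hitPlace hμ hμ1 hf x)]
  refine integral_congr_ae (ae_of_all _ fun g => integral_congr_ae ?_)
  filter_upwards [ae_hitPlace_consIncr hμ hx g] with ω hω
  rw [hω]

omit [Group.FG G] in
theorem lintegral_hitPlace (hμ : IsAdapted μ) {x : G} (hx : x ∉ H) (φ : H → ℝ≥0∞) :
    ∫⁻ ω, φ (hitPlace H 0 x ω) ∂(incrementLaw μ) =
      ∫⁻ g, ∫⁻ ω, φ (hitPlace H 0 (x * g) ω) ∂(incrementLaw μ) ∂μ := by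
  rw [lintegral_incrementLaw μ (measurable_comp_hitPlace φ 0 x)]
  refine lintegral_congr fun g => lintegral_congr_ae ?_
  filter_upwards [ae_hitPlace_consIncr hμ hx g] with ω hω
  rw [hω]

omit [Group.FG G] in
theorem hittingMeasure_eq_map (hμ : IsAdapted μ) :
    hittingMeasure H μ = (incrementLaw μ).map (hitPlace H 1 1) := by
  rw [hittingMeasure, Measure.restrict_eq_self_of_ae_mem]
  filter_upwards [ae_hitTime_one_ne_top (H := H) hμ 1] with ω hω
  exact lt_top_iff_ne_top.2 hω

omit [Group.FG G] in
theorem isProbabilityMeasure_hittingMeasure (hμ : IsAdapted μ) :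
    IsProbabilityMeasure (hittingMeasure H μ) := by
  rw [hittingMeasure_eq_map hμ]
  exact Measure.isProbabilityMeasure_map (measurable_hitPlace H 1 1).aemeasurable

omit [Group.FG G] in
theorem ae_hitPlace_one_consIncr (hμ : IsAdapted μ) (g : G) :
    ∀ᵐ ω ∂(incrementLaw μ), hitPlace H 1 1 (consIncr g ω) = hitPlace H 0 g ω := by
  filter_upwards [ae_hitTime_ne_top (H := H) hμ (1 * g)] with ω hω
  rw [hitPlace_consIncr g hω, one_mul]

omit [Group.FG G] in
-- After a first increment `g` from the identity, τ⁺ becomes τ for the walk started at `g`.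
theorem lintegral_hittingMeasure (hμ : IsAdapted μ) (φ : H → ℝ≥0∞) :
    ∫⁻ y, φ y ∂(hittingMeasure H μ) =
      ∫⁻ g, ∫⁻ ω, φ (hitPlace H 0 g ω) ∂(incrementLaw μ) ∂μ := by
  rw [hittingMeasure_eq_map hμ, lintegral_map Measurable.of_discrete (measurable_hitPlace H 1 1),
    lintegral_incrementLaw μ (measurable_comp_hitPlace φ 1 1)]
  refine lintegral_congr fun g => lintegral_congr_ae ?_
  filter_upwards [ae_hitPlace_one_consIncr (H := H) hμ g] with ω hω
  rw [hω]

/-- Given the first increment `g`, the expected length of the hitting place is at most A(|g| + m₁T),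
which is integrable in `g`. -/
theorem hasFirstMoment_hittingMeasure (hμ : IsAdapted μ) (hμ1 : HasFirstMoment μ) :
    HasFirstMoment (hittingMeasure H μ) := by
  intro T hT
  obtain ⟨S, hS⟩ := exists_isSymmGen G
  obtain ⟨A, hA⟩ := exists_wordLength_subgroup_le hS hT
  have hfin := ENNReal.mul_lt_top (hμ1 S hS) (iSup_expectedHitTime_lt_top (H := H) hμ)
  rw [firstMoment, lintegral_hittingMeasure hμ]
  have hb : ∀ g, ∫⁻ ω, (wordLength T (hitPlace H 0 g ω) : ℝ≥0∞) ∂(incrementLaw μ) ≤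
      A * (wordLength S g + firstMoment S μ * ⨆ x, expectedHitTime H μ x) := by
    intro g
    have h1 := lintegral_wordLength_hitPlace_le (H := H) hμ hS 1 g
    rw [Subgroup.coe_one, one_mul, inv_one] at h1
    simp only [one_mul] at h1
    refine (lintegral_mono (g := fun ω => A * (wordLength S (hitPlace H 0 g ω : G) : ℝ≥0∞))
      fun ω => by dsimp only; exact_mod_cast hA _).trans ?_
    rw [lintegral_const_mul _ (measurable_comp_hitPlace
      (fun y : H => (wordLength S (y : G) : ℝ≥0∞)) 0 g)]
    gcongr
    refine h1.trans ?_
    gcongr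
    exact le_iSup (expectedHitTime H μ) g
  refine (lintegral_mono hb).trans_lt ?_
  rw [lintegral_const_mul _ Measurable.of_discrete, lintegral_add_right _ measurable_const]
  refine ENNReal.mul_lt_top (by simp) (ENNReal.add_lt_top.2 ⟨hμ1 S hS, ?_⟩)
  simpa using hfin

/-- Left equivariance carries `h` into the starting point. The identity turns averages for the
hitting law into averages of the induced function for `μ`. -/
theorem integral_hittingMeasure (hμ : IsAdapted μ) (hμ1 : HasFirstMoment μ) {f : H → ℂ}
    (hf : IsLipschitz f) (h : H) :
    ∫ y, f (h * y) ∂(hittingMeasure H μ) = ∫ g, ind H μ f (h * g) ∂μ := by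
  have := isProbabilityMeasure_hittingMeasure (H := H) hμ
  have hi := hf.integrable (hasFirstMoment_hittingMeasure (H := H) hμ hμ1) h
  have hm := (measurable_hitPlace H 1 1).aemeasurable (μ := incrementLaw μ)
  rw [hittingMeasure_eq_map hμ] at hi ⊢
  rw [integral_map hm Measurable.of_discrete.aestronglyMeasurable,
    integral_incrementLaw μ (measurable_comp_hitPlace (fun y => f (h * y)) 1 1)
      (hi.comp_aemeasurable hm)]
  refine integral_congr_ae (ae_of_all _ fun g => integral_congr_ae ?_)
  filter_upwards [ae_hitPlace_one_consIncr (H := H) hμ g, ae_hitTime_ne_top (H := H) hμ g] with ω hω hτ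
  rw [hω, hitPlace_left_mul h hτ]

/-- Uniqueness for the Dirichlet problem among Lipschitz functions. -/
theorem eq_ind_res (hμ : IsAdapted μ) (hμ1 : HasFirstMoment μ) {u : G → ℂ} (hu : IsLipschitz u)
    (hharm : ∀ x ∉ H, u x = ∫ g, u (x * g) ∂μ) : ind H μ (res H u) = u := by
  have hr : IsLipschitz (res H u) := hu.comp H.subtype
  have hi := isLipschitz_ind hμ hμ1 hr
  set d : G → ℂ := u - ind H μ (res H u) with hd
  have hd0 : ∀ h : H, d h = 0 := fun h => by simp [hd, ind_coe, res]
  have hdharm : ∀ x ∉ H, d x = ∫ g, d (x * g) ∂μ := fun x hx => by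
    simp only [hd, Pi.sub_apply]
    rw [integral_sub (hu.integrable hμ1 x) (hi.integrable hμ1 x), ← hharm x hx,
      ← ind_eq_integral hμ hμ1 hr hx]
  obtain ⟨C, hC⟩ := bounded_of_isLipschitz_of_eq_zero (hu.sub hi) hd0
  -- Iterating harmonicity off `H`: only paths that have avoided `H` up to time `n` contribute,
  -- since `d` vanishes on `H`.
  have key : ∀ n x, ‖d x‖ₑ ≤ C * hitTail H μ x n := by
    intro n
    induction n with
    | zero =>
      intro x
      by_cases hx : x ∈ H
      · simp [hd0 ⟨x, hx⟩]
      · rw [hitTail_zero_of_notMem hx, mul_one]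
        exact hC x
    | succ n ih =>
      intro x
      by_cases hx : x ∈ H
      · simp [hd0 ⟨x, hx⟩]
      · rw [hdharm x hx, hitTail_succ hx, ← lintegral_const_mul _ Measurable.of_discrete]
        exact (enorm_integral_le_lintegral_enorm _).trans (lintegral_mono fun g => ih _)
  funext x
  have hsum : ∑' n, hitTail H μ x n ≠ ∞ := by
    rw [← expectedHitTime_eq_tsum]
    exact ((le_iSup (expectedHitTime H μ) x).trans_lt (iSup_expectedHitTime_lt_top hμ)).ne
  have hlim := ENNReal.Tendsto.const_mul (a := (C : ℝ≥0∞))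
    (ENNReal.tendsto_atTop_zero_of_tsum_ne_top hsum) (Or.inr (by simp))
  rw [mul_zero] at hlim
  have h0 : ‖d x‖ₑ = 0 := le_antisymm (ge_of_tendsto' hlim fun n => key n x) (by simp)
  have h1 : u x - ind H μ (res H u) x = 0 := by simpa [hd] using h0
  exact (sub_eq_zero.1 h1).symm

omit [Group.FG G] in
-- A word of positive-mass increments with product `h ∈ H` is cut at its visits to `H`; the pieces
-- between successive visits are atoms of the hitting law.
theorem isAdapted_hittingMeasure (hμ : IsAdapted μ) : IsAdapted (hittingMeasure H μ) := by
  set C := Subsemigroup.closure {y : H | hittingMeasure H μ {y} ≠ 0} with hC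
  have hpos : ∀ (s : G) (y : H), μ {s} ≠ 0 →
      ∫⁻ ω, ({y} : Set H).indicator 1 (hitPlace H 0 s ω) ∂(incrementLaw μ) ≠ 0 → y ∈ C := by
    intro s y hs hy
    refine Subsemigroup.subset_closure ?_
    rw [Set.mem_ofPred_eq, ← lintegral_indicator_one (MeasurableSet.singleton y),
      lintegral_hittingMeasure hμ]
    exact lintegral_ne_zero_of_singleton hs hy
  -- Here `y` is the first visit to `H` along the path from `x`; the rest of the path, if any,
  -- contributes a factor `c ∈ C`.
  have key : ∀ (l : List G) (x : G), (∀ s ∈ l, μ {s} ≠ 0) → ∀ h : H, x * l.prod = h →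
      ∃ y : H, ∫⁻ ω, ({y} : Set H).indicator 1 (hitPlace H 0 x ω) ∂(incrementLaw μ) ≠ 0 ∧
        (h = y ∨ ∃ c ∈ C, h = y * c) := by
    intro l
    induction l with
    | nil =>
      intro x _ h hx
      obtain rfl : x = h := by simpa using hx
      exact ⟨h, by simp [hitPlace_of_mem h.2], Or.inl rfl⟩
    | cons s l ih =>
      intro x hl h hx
      have hl' : ∀ s ∈ l, μ {s} ≠ 0 := fun a ha => hl a (by simp [ha])
      have hs : μ {s} ≠ 0 := hl s (by simp)
      by_cases hxH : x ∈ H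
      · lift x to H using hxH
        -- The path is already in `H` at time zero. The remaining word, translated back to the
        -- identity, has first step `s`, so its next visit is an atom of the hitting law.
        refine ⟨x, by simp [hitPlace_of_mem x.2], Or.inr ⟨x⁻¹ * h, ?_, by simp⟩⟩
        obtain ⟨y, hy, hc⟩ := ih s hl' (x⁻¹ * h) (by simp [← hx])
        have hyC := hpos s y hs hy
        rcases hc with hc | ⟨c, hc, hc'⟩
        · rwa [hc]
        · rw [hc']; exact C.mul_mem hyC hc
      · obtain ⟨y, hy, hc⟩ := ih (x * s) hl' h (by rw [← hx, List.prod_cons, mul_assoc])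
        refine ⟨y, ?_, hc⟩
        rw [lintegral_hitPlace hμ hxH (({y} : Set H).indicator 1)]
        exact lintegral_ne_zero_of_singleton hs hy
  refine eq_top_iff.2 fun h _ => ?_
  -- A first letter is split off so that the word is nonempty even for `h = 1`: the hitting law
  -- concerns positive times.
  obtain ⟨s, hs⟩ := hμ.exists_ne_zero
  obtain ⟨l, hl, hl'⟩ := hμ.exists_list_prod (s⁻¹ * h)
  obtain ⟨y, hy, hc⟩ := key l s hl h (by rw [hl', mul_inv_cancel_left])
  have hyC := hpos s y hs hy
  rcases hc with rfl | ⟨c, hc, rfl⟩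
  exacts [hyC, C.mul_mem hyC hc]

end Induction

/-! ### The isomorphism, left equivariance and transitivity -/

section Main

variable {G : Type*} [Group G] [Group.FG G] [Countable G] [MeasurableSpace G]
  [DiscreteMeasurableSpace G] {H : Subgroup G} [H.FiniteIndex] {μ : Measure G}
  [IsProbabilityMeasure μ]

theorem ind_res (hμ : IsAdapted μ) (hμ1 : HasFirstMoment μ) {f : G → ℂ} (hf : f ∈ LHF μ) :
    ind H μ (res H f) = f :=
  eq_ind_res hμ hμ1 hf.1 fun x _ => (hf.2 x).2

omit [Group.FG G] [Countable G] [DiscreteMeasurableSpace G] [H.FiniteIndex] in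
theorem res_ind (f : H → ℂ) : res H (ind H μ f) = f :=
  funext fun h => ind_coe f h

theorem isHarmonic_hittingMeasure_iff (hμ : IsAdapted μ) (hμ1 : HasFirstMoment μ) {f : H → ℂ}
    (hf : IsLipschitz f) :
    IsHarmonic (hittingMeasure H μ) f ↔ ∀ h : H, f h = ∫ g, ind H μ f (h * g) ∂μ := by
  have := isProbabilityMeasure_hittingMeasure (H := H) hμ
  have hi := fun h => hf.integrable (hasFirstMoment_hittingMeasure (H := H) hμ hμ1) h
  simp only [IsHarmonic, hi, true_and, integral_hittingMeasure hμ hμ1 hf]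

theorem res_mem_LHF (hμ : IsAdapted μ) (hμ1 : HasFirstMoment μ) {f : G → ℂ} (hf : f ∈ LHF μ) :
    res H f ∈ LHF (hittingMeasure H μ) := by
  have hr : IsLipschitz (res H f) := hf.1.comp H.subtype
  refine ⟨hr, (isHarmonic_hittingMeasure_iff hμ hμ1 hr).2 fun h => ?_⟩
  rw [ind_res hμ hμ1 hf]
  exact (hf.2 h).2

theorem ind_mem_LHF (hμ : IsAdapted μ) (hμ1 : HasFirstMoment μ) {f : H → ℂ}
    (hf : f ∈ LHF (hittingMeasure H μ)) : ind H μ f ∈ LHF μ := by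
  have hl := isLipschitz_ind hμ hμ1 hf.1
  refine ⟨hl, fun x => ⟨hl.integrable hμ1 x, ?_⟩⟩
  by_cases hx : x ∈ H
  · lift x to H using hx
    rw [ind_coe]
    exact (isHarmonic_hittingMeasure_iff hμ hμ1 hf.1).1 hf.2 x
  · exact ind_eq_integral hμ hμ1 hf.1 hx

/-- Restriction as a linear isomorphism between spaces of Lipschitz harmonic functions, with
harmonic induction as its inverse. -/
noncomputable def resEquiv (hμ : IsAdapted μ) (hμ1 : HasFirstMoment μ) :
    LHF μ ≃ₗ[ℂ] LHF (hittingMeasure H μ) where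
  toFun f := ⟨res H f, res_mem_LHF hμ hμ1 f.2⟩
  map_add' _ _ := rfl
  map_smul' _ _ := rfl
  invFun f := ⟨ind H μ f, ind_mem_LHF hμ hμ1 f.2⟩
  left_inv f := Subtype.ext (ind_res hμ hμ1 f.2)
  right_inv _ := Subtype.ext (res_ind _)

omit [Group.FG G] [Countable G] [DiscreteMeasurableSpace G] [IsProbabilityMeasure μ] in
theorem leftTranslate_mem_LHF {f : G → ℂ} (hf : f ∈ LHF μ) (h : G) :
    leftTranslate h f ∈ LHF μ := by
  refine ⟨hf.1.leftTranslate h, fun k => ?_⟩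
  simpa only [leftTranslate, mul_assoc] using hf.2 (h⁻¹ * k)

omit [Group.FG G] in
theorem ind_leftTranslate (hμ : IsAdapted μ) (f : H → ℂ) (h : H) :
    ind H μ (leftTranslate h f) = leftTranslate (h : G) (ind H μ f) := by
  funext x
  refine integral_congr_ae ?_
  filter_upwards [ae_hitTime_ne_top (H := H) hμ x] with ω hω
  rw [leftTranslate, ← hitPlace_left_mul h⁻¹ hω, Subgroup.coe_inv]

/-! ### Nested subgroups -/

section Nested

variable {K : Subgroup G} [K.FiniteIndex] (hKH : K ≤ H)

/-- The function induced from `K` is harmonic off `K`, hence off `H`, so uniqueness makes it induced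
from its restriction to `H`. That restriction is then harmonic for the hitting law on `H` off `K`,
and uniqueness inside `H` gives the other identity. Harmonicity of `f` plays no role, so indicators
are allowed. -/
theorem ind_subgroupOf (hμ : IsAdapted μ) (hμ1 : HasFirstMoment μ) {f : K → ℂ}
    (hf : IsLipschitz f) :
    ind (K.subgroupOf H) (hittingMeasure H μ) (f ∘ Subgroup.subgroupOfEquivOfLe hKH) =
      res H (ind K μ f) ∧ ind H μ (res H (ind K μ f)) = ind K μ f := by
  have := isProbabilityMeasure_hittingMeasure (H := H) hμ
  have hu := isLipschitz_ind hμ hμ1 hf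
  have hr : IsLipschitz (res H (ind K μ f)) := hu.comp H.subtype
  have hind : ind H μ (res H (ind K μ f)) = ind K μ f :=
    eq_ind_res hμ hμ1 hu fun x hx => ind_eq_integral hμ hμ1 hf fun hx' => hx (hKH hx')
  refine ⟨?_, hind⟩
  have hres : f ∘ Subgroup.subgroupOfEquivOfLe hKH =
      res (K.subgroupOf H) (res H (ind K μ f)) :=
    funext fun k => (ind_coe f (Subgroup.subgroupOfEquivOfLe hKH k)).symm
  rw [hres]
  refine eq_ind_res (isAdapted_hittingMeasure hμ) (hasFirstMoment_hittingMeasure hμ hμ1) hr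
    fun h hh => ?_
  rw [integral_hittingMeasure hμ hμ1 hr, hind]
  exact ind_eq_integral hμ hμ1 hf hh

/-- For the indicator of a point, both integrals equal the `μ`-average of the function induced from
`K` to `G`. -/
theorem hittingMeasure_subgroupOf (hμ : IsAdapted μ) (hμ1 : HasFirstMoment μ) :
    (hittingMeasure (K.subgroupOf H) (hittingMeasure H μ)).map
      (Subgroup.subgroupOfEquivOfLe hKH) = hittingMeasure K μ := by
  have := isProbabilityMeasure_hittingMeasure (H := H) hμ
  have := isProbabilityMeasure_hittingMeasure (H := K) hμ
  have hμ' := isAdapted_hittingMeasure (H := H) hμ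
  have hμ1' := hasFirstMoment_hittingMeasure (H := H) hμ hμ1
  have := isProbabilityMeasure_hittingMeasure (H := K.subgroupOf H) hμ'
  have he : Measurable (Subgroup.subgroupOfEquivOfLe hKH) := Measurable.of_discrete
  refine Measure.ext_of_singleton fun k => ?_
  let f : K → ℂ := ({k} : Set K).indicator 1
  have hf : IsLipschitz f := isLipschitz_of_bounded (C := 1) fun x => by
    by_cases hx : x = k <;> simp [f, hx]
  obtain ⟨h1, h2⟩ := ind_subgroupOf hKH hμ hμ1 hf
  have hf' : IsLipschitz (f ∘ Subgroup.subgroupOfEquivOfLe hKH) :=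
    hf.comp (Subgroup.subgroupOfEquivOfLe hKH).toMonoidHom
  have hr : IsLipschitz (res H (ind K μ f)) := (isLipschitz_ind hμ hμ1 hf).comp H.subtype
  have e1 := integral_hittingMeasure hμ hμ1 hf 1
  have e2 := integral_hittingMeasure hμ hμ1 hr 1
  have e3 := integral_hittingMeasure hμ' hμ1' hf' 1
  rw [h2] at e2
  rw [h1] at e3
  simp only [one_mul, Subgroup.coe_one] at e1 e2 e3
  have e4 : ∫ y, f y ∂(hittingMeasure (K.subgroupOf H) (hittingMeasure H μ)).map
      (Subgroup.subgroupOfEquivOfLe hKH) = ∫ y, f y ∂(hittingMeasure K μ) := by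
    rw [integral_map he.aemeasurable Measurable.of_discrete.aestronglyMeasurable, e1, ← e2]
    exact e3
  have := Measure.isProbabilityMeasure_map he.aemeasurable
    (μ := hittingMeasure (K.subgroupOf H) (hittingMeasure H μ))
  simp only [f] at e4
  rw [integral_indicator (MeasurableSet.singleton k),
    integral_indicator (MeasurableSet.singleton k)] at e4
  simpa [Measure.real, ENNReal.toReal_eq_toReal_iff] using e4

end Nested

end Main

/-! ### Transport along isomorphisms -/

section Transport

variable {G G' : Type*} [Group G] [Group G'] [MeasurableSpace G] [MeasurableSpace G']
  [DiscreteMeasurableSpace G] [DiscreteMeasurableSpace G'] {μ : Measure G} (φ : G ≃* G')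

theorem comp_symm_mem_LHF [Group.FG G] {f : G → ℂ} (hf : f ∈ LHF μ) :
    f ∘ φ.symm ∈ LHF (μ.map φ) := by
  have hφ : Measurable φ := Measurable.of_discrete
  refine ⟨hf.1.comp φ.symm.toMonoidHom, fun k => ?_⟩
  obtain ⟨h1, h2⟩ := hf.2 (φ.symm k)
  rw [integrable_map_measure Measurable.of_discrete.aestronglyMeasurable hφ.aemeasurable,
    integral_map hφ.aemeasurable Measurable.of_discrete.aestronglyMeasurable]
  simpa [Function.comp_def] using And.intro h1 h2

theorem mem_LHF_iff_comp_symm [Group.FG G] (f : G → ℂ) :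
    f ∈ LHF μ ↔ f ∘ φ.symm ∈ LHF (μ.map φ) := by
  have : Group.FG G' := Group.fg_of_surjective (f := φ.toMonoidHom) φ.surjective
  refine ⟨comp_symm_mem_LHF φ, fun h => ?_⟩
  have h' := comp_symm_mem_LHF φ.symm h
  rw [Measure.map_map Measurable.of_discrete Measurable.of_discrete] at h'
  simpa [Function.comp_def] using h'

theorem IsAdapted.map (hμ : IsAdapted μ) : IsAdapted (μ.map φ) := by
  have hs : {g : G' | μ.map φ {g} ≠ 0} = φ '' {g : G | μ {g} ≠ 0} := by
    ext g
    obtain ⟨g, rfl⟩ := φ.surjective g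
    have : φ ⁻¹' {φ g} = {g} := by ext; simp
    simp [Measure.map_apply (Measurable.of_discrete (f := φ)) (MeasurableSet.singleton _), this]
  have h := MulHom.map_mclosure (φ : G →ₙ* G') {g : G | μ {g} ≠ 0}
  rw [IsAdapted, hs]
  rw [IsAdapted] at hμ
  rw [hμ] at h
  refine h.symm.trans ?_
  rw [← MulHom.srange_eq_map]
  exact MulHom.srange_eq_top_iff_surjective.2 φ.surjective

variable [Countable G] [Countable G'] [IsProbabilityMeasure μ]

omit [DiscreteMeasurableSpace G'] [Countable G] [Countable G'] in
theorem incrementLaw_map :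
    incrementLaw (μ.map φ) = (incrementLaw μ).map fun ω i => φ (ω i) :=
  (Measure.infinitePi_map_pi (fun _ : ℕ => μ) fun _ => Measurable.of_discrete).symm

variable {H : Subgroup G} {H' : Subgroup G'} (e : H ≃* H')

omit [MeasurableSpace G] [MeasurableSpace G'] [DiscreteMeasurableSpace G]
  [DiscreteMeasurableSpace G'] [Countable G] [Countable G'] in
-- The image walk visits `H'` exactly when the original walk visits `H`.
theorem hitPlace_map (hH : ∀ x, φ x ∈ H' ↔ x ∈ H) (he : ∀ h : H, (e h : G') = φ h)
    {n : ℕ} {x : G} {ω : ℕ → G} (hτ : hitTime H n x ω ≠ ⊤) :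
    hitPlace H' n (φ x) (fun i => φ (ω i)) = e (hitPlace H n x ω) := by
  have hw := fun t => walk_map φ.toMonoidHom x t ω
  simp only [MulEquiv.coe_toMonoidHom] at hw
  have h : hitTime H n x ω = hitTime H' n (φ x) fun i => φ (ω i) :=
    hitTime_congr fun t _ => by rw [hw, hH]
  obtain ⟨k, hk⟩ := ENat.ne_top_iff_exists.1 hτ
  refine Subtype.ext ?_
  rw [he, coe_hitPlace (h.symm.trans hk.symm), coe_hitPlace hk.symm, hw]

variable [H.FiniteIndex] [H'.FiniteIndex]

theorem hittingMeasure_map (hμ : IsAdapted μ) (hH : ∀ x, φ x ∈ H' ↔ x ∈ H)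
    (he : ∀ h : H, (e h : G') = φ h) :
    hittingMeasure H' (μ.map φ) = (hittingMeasure H μ).map e := by
  have := Measure.isProbabilityMeasure_map (μ := μ)
    (Measurable.of_discrete (f := φ)).aemeasurable
  have hφ : Measurable fun (ω : ℕ → G) i => φ (ω i) :=
    measurable_pi_iff.2 fun i => Measurable.of_discrete.comp (measurable_pi_apply i)
  rw [hittingMeasure_eq_map (hμ.map φ), hittingMeasure_eq_map hμ, incrementLaw_map,
    Measure.map_map (measurable_hitPlace _ _ _) hφ,
    Measure.map_map Measurable.of_discrete (measurable_hitPlace _ _ _)]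
  refine Measure.map_congr ?_
  filter_upwards [ae_hitTime_one_ne_top (H := H) hμ 1] with ω hω
  simpa using hitPlace_map φ e hH he hω

omit [H'.FiniteIndex] in
theorem ind_comp_symm (hμ : IsAdapted μ) (hH : ∀ x, φ x ∈ H' ↔ x ∈ H)
    (he : ∀ h : H, (e h : G') = φ h) (f : H → ℂ) :
    ind H' (μ.map φ) (f ∘ e.symm) = ind H μ f ∘ φ.symm := by
  have := Measure.isProbabilityMeasure_map (μ := μ)
    (Measurable.of_discrete (f := φ)).aemeasurable
  have hφ : Measurable fun (ω : ℕ → G) i => φ (ω i) :=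
    measurable_pi_iff.2 fun i => Measurable.of_discrete.comp (measurable_pi_apply i)
  funext y
  obtain ⟨x, rfl⟩ := φ.surjective y
  rw [ind, incrementLaw_map, integral_map hφ.aemeasurable
    (measurable_comp_hitPlace (f ∘ e.symm) 0 (φ x)).aestronglyMeasurable, Function.comp,
    φ.symm_apply_apply]
  refine integral_congr_ae ?_
  filter_upwards [ae_hitTime_ne_top (H := H) hμ x] with ω hω
  rw [hitPlace_map φ e hH he hω, Function.comp, e.symm_apply_apply]

end Transport

end FiniteIndexLHF

theorem theoremB {G : Type*} [Group G] [Group.FG G] [MeasurableSpace G]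
    [DiscreteMeasurableSpace G] (H : Subgroup G) [H.FiniteIndex]
    (μ : Measure G) [IsProbabilityMeasure μ] (hμa : IsAdapted μ) (hμs : IsSmooth μ) :
    -- the hitting law is a probability measure, expected hitting times are bounded, and the
    -- expectation that defines harmonic induction exists
    IsProbabilityMeasure (hittingMeasure H μ) ∧
    (⨆ x : G, expectedHitTime H μ x) < ∞ ∧
    (∀ f ∈ LHF (hittingMeasure H μ), ∀ x : G,
      Integrable (fun ω => f (hitPlace H 0 x ω)) (incrementLaw μ)) ∧
    -- restriction and induction are inverse linear isomorphisms
    (∃ e : LHF μ ≃ₗ[ℂ] LHF (hittingMeasure H μ),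
      (∀ f : LHF μ, (e f : H → ℂ) = res H f) ∧
      (∀ f : LHF (hittingMeasure H μ), (e.symm f : G → ℂ) = ind H μ f)) ∧
    -- Lipschitz control
    (∀ (SG : Finset G) (SH : Finset H), IsSymmGen SG → IsSymmGen SH →
      firstMoment SG μ < ∞ ∧
      (∃ A : ℝ≥0, 1 ≤ A ∧ ∀ h : H, (wordLength SH h : ℝ≥0) ≤ A * wordLength SG (h : G)) ∧
      (∀ f ∈ LHF μ, gradNorm SH (res H f) ≤
        ((SH.sup fun s => wordLength SG (s : G) : ℕ) : ℝ≥0∞) * gradNorm SG f) ∧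
      (∀ A : ℝ≥0, 1 ≤ A →
        (∀ h : H, (wordLength SH h : ℝ≥0) ≤ A * wordLength SG (h : G)) →
        ∀ F : Finset G, Subgroup.IsComplement (H : Set G) (F : Set G) → 1 ∈ F →
        ∀ f ∈ LHF (hittingMeasure H μ), gradNorm SG (ind H μ f) ≤
          (A : ℝ≥0∞) * ((4 * ((F.sup fun g => wordLength SG g : ℕ) : ℝ≥0∞) + 1)
            + 2 * firstMoment SG μ * ⨆ x : G, expectedHitTime H μ x) * gradNorm SH f)) ∧
    -- (F1) nested subgroups; `K`, as a subgroup of `H`, is identified with `K`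
    (∀ (K : Subgroup G) (hKH : K ≤ H), K.FiniteIndex →
      (hittingMeasure (K.subgroupOf H) (hittingMeasure H μ)).map
        (Subgroup.subgroupOfEquivOfLe hKH) = hittingMeasure K μ ∧
      (∀ f ∈ LHF μ, res (K.subgroupOf H) (res H f) =
        res K f ∘ Subgroup.subgroupOfEquivOfLe hKH) ∧
      (∀ f ∈ LHF (hittingMeasure K μ),
        (∀ x : H, Integrable
          (fun ω => f (Subgroup.subgroupOfEquivOfLe hKH (hitPlace (K.subgroupOf H) 0 x ω)))
          (incrementLaw (hittingMeasure H μ))) ∧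
        ind (K.subgroupOf H) (hittingMeasure H μ) (f ∘ Subgroup.subgroupOfEquivOfLe hKH)
          ∈ LHF (hittingMeasure H μ) ∧
        ind H μ (ind (K.subgroupOf H) (hittingMeasure H μ)
          (f ∘ Subgroup.subgroupOfEquivOfLe hKH)) = ind K μ f)) ∧
    -- (F2) equivariance under left translations by elements of `H`
    (∀ h : H,
      (∀ f ∈ LHF μ, leftTranslate (h : G) f ∈ LHF μ ∧
        res H (leftTranslate (h : G) f) = leftTranslate h (res H f)) ∧
      (∀ f ∈ LHF (hittingMeasure H μ), leftTranslate h f ∈ LHF (hittingMeasure H μ) ∧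
        ind H μ (leftTranslate h f) = leftTranslate (h : G) (ind H μ f))) ∧
    -- (F3) conjugation naturality
    (∀ g : G,
      hittingMeasure (conjSubgroup g H) (μ.map (MulAut.conj g)) =
        (hittingMeasure H μ).map (conjEquiv g H) ∧
      (∀ f : G → ℂ, f ∈ LHF μ ↔ f ∘ (MulAut.conj g).symm ∈ LHF (μ.map (MulAut.conj g))) ∧
      (∀ f : H → ℂ, f ∈ LHF (hittingMeasure H μ) ↔ f ∘ (conjEquiv g H).symm ∈
        LHF (hittingMeasure (conjSubgroup g H) (μ.map (MulAut.conj g)))) ∧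
      (∀ f ∈ LHF μ, res (conjSubgroup g H) (f ∘ (MulAut.conj g).symm) =
        res H f ∘ (conjEquiv g H).symm) ∧
      (∀ f ∈ LHF (hittingMeasure H μ),
        ind (conjSubgroup g H) (μ.map (MulAut.conj g)) (f ∘ (conjEquiv g H).symm) =
          ind H μ f ∘ (MulAut.conj g).symm)) := by
  have := countable_of_fg G
  have hμ1 := hμs.hasFirstMoment
  refine ⟨isProbabilityMeasure_hittingMeasure hμa, iSup_expectedHitTime_lt_top hμa,
    fun f hf x => integrable_comp_hitPlace hμa hμ1 hf.1 x,
    ⟨resEquiv hμa hμ1, fun _ => rfl, fun _ => rfl⟩, fun SG SH hSG hSH => ⟨hμ1 SG hSG, ?_, ?_, ?_⟩,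
    fun K hKH hK => ⟨hittingMeasure_subgroupOf hKH hμa hμ1, fun _ _ => rfl, fun f hf => ?_⟩,
    fun h => ⟨fun f hf => ⟨leftTranslate_mem_LHF hf h, rfl⟩, fun f hf =>
      ⟨leftTranslate_mem_LHF hf h, ind_leftTranslate hμa f h⟩⟩, fun g => ?_⟩
  · obtain ⟨C, hC⟩ := exists_wordLength_subgroup_le hSG hSH
    refine ⟨max 1 C, le_max_left _ _, fun h => ?_⟩
    calc (wordLength SH h : ℝ≥0) ≤ C * wordLength SG (h : G) := by exact_mod_cast hC h
      _ ≤ _ := by gcongr; exact le_max_right _ _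
  · exact fun f _ => gradNorm_comp_le hSG SH H.subtype f
  · exact fun A _ hA F hF _ f hf => gradNorm_ind_le hμa hμ1 hSG hSH hA hF hf.1
  · obtain ⟨h1, h2⟩ := ind_subgroupOf hKH hμa hμ1 hf.1
    have := isProbabilityMeasure_hittingMeasure (H := H) hμa
    refine ⟨fun x => ?_, ?_, by rw [h1, h2]⟩
    · exact integrable_comp_hitPlace (isAdapted_hittingMeasure hμa)
        (hasFirstMoment_hittingMeasure hμa hμ1)
        (hf.1.comp (Subgroup.subgroupOfEquivOfLe hKH).toMonoidHom) x
    -- Induction from `K` to `H` is induction to `G` followed by restriction, and both preserve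
    -- Lipschitz harmonic functions.
    · rw [h1]
      exact res_mem_LHF hμa hμ1 (ind_mem_LHF hμa hμ1 hf)
  · have hH : ∀ x, MulAut.conj g x ∈ conjSubgroup g H ↔ x ∈ H := fun x =>
      Subgroup.mem_map_iff_mem (MulAut.conj g).injective
    have he : ∀ h : H, (conjEquiv g H h : G) = MulAut.conj g h := fun _ => rfl
    have : (conjSubgroup g H).FiniteIndex := ⟨by
      rw [conjSubgroup, Subgroup.index_map_of_bijective (MulAut.conj g).bijective]
      exact Subgroup.FiniteIndex.index_ne_zero⟩
    have hmap := hittingMeasure_map (MulAut.conj g) (conjEquiv g H) hμa hH he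
    refine ⟨hmap, mem_LHF_iff_comp_symm _, fun f => ?_, fun f _ => ?_, fun f _ =>
      ind_comp_symm (MulAut.conj g) (conjEquiv g H) hμa hH he f⟩
    · rw [hmap]
      exact mem_LHF_iff_comp_symm _ f
    · funext y
      obtain ⟨h, rfl⟩ := (conjEquiv g H).surjective y
      simp [res, mul_assoc]
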